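/- Let $k$ be a field and let $\Gamma$ be a finite quiver with a linear order on its set of vertices such that every arrow goes from a smaller to a larger vertex. Assume that $\Gamma$ is connected (as an unoriented graph) and nontrivial (it has more than one vertex), and let $l$ be the maximal length of a path in $\Gamma$. Let $R\subset k\Gamma$ be the ideal of the path algebra spanned by the paths of positive length, let $I\subset R^2$ be a two-sided ideal of $k\Gamma$, and let $A=k\Gamma/I$ be the corresponding path algebra with relations. Let $\operatorname{Perf}A$ be the full subcategory of the derived category $D(A)$ of right $A$-modules formed by the objects isomorphic to bounded complexes of finitely generated projective modules. A Serre functor on $\operatorname{Perf}A$ is a functor $S$ from $\operatorname{Perf}A$ to itself with $k$-linear isomorphisms $\operatorname{Hom}(X,Y)\cong\operatorname{Hom}(Y,S(X))^*$, functorial in $X$ and $Y$. An object $G$ is a classical generator of $\operatorname{Perf} A$ if every object of $\operatorname{Perf}A$ is obtained from $G$ by finitely many shifts, finite direct sums, extensions and direct summands. Then: 1. $\operatorname{Perf}A$ has a Serre functor and a classical generator, and for every Serre functor $S$ and every classical generator $G$ the lower Serre dimension $$\operatorname{LSdim}(A)=\liminf_{m\to+\infty}\frac{-\sup\{i\in\mathbb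 Z\mid \operatorname{Hom}(G,S^m(G)[i])\neq 0\}}{m}$$ satisfies $\operatorname{LSdim}(A)\ge\frac1{l+2}$; in particular $\operatorname{LSdim}(A)>0$. 2. Let $A^*=\operatorname{Hom}_k(A,k)$ be the Serre bimodule, with $(a\cdot f\cdot b)(x)=f(bxa)$. Its $(l+2)$-fold underived tensor power over $A$ vanishes: $$(A^*)^{\otimes_A(l+2)}=A^*\otimes_A\cdots\otimes_AA^*=0.$$ -/

import Mathlib

open CategoryTheory Filter

universe u v w u'

noncomputable section

/-! ### Path algebras of finite quivers -/

/-- All paths of the quiver `V`, with arbitrary source and target. -/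
abbrev QuiverPath (V : Type v) [Quiver.{w} V] : Type (max v w) :=
  Σ a b : V, Quiver.Path a b

/-- The path algebra `kΓ`: the `k`-vector space with basis all paths of the quiver. -/
def PathAlgebra (k : Type u) [Field k] (V : Type v) [Quiver.{w} V] : Type (max u v w) :=
  QuiverPath V →₀ k

namespace PathAlgebra

section Basis

variable (k : Type u) [Field k] (V : Type v) [Quiver.{w} V]

instance : AddCommGroup (PathAlgebra k V) := inferInstanceAs (AddCommGroup (QuiverPath V →₀ k))

instance : Module k (PathAlgebra k V) := inferInstanceAs (Module k (QuiverPath V →₀ k))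

/-- The basis of the path algebra formed by the paths. -/
def pathBasis : Module.Basis (QuiverPath V) k (PathAlgebra k V) :=
  Module.Basis.ofRepr (LinearEquiv.refl k (QuiverPath V →₀ k))

variable {V}

/-- The basis element given by a path. -/
def ofPath (p : QuiverPath V) : PathAlgebra k V := pathBasis k V p

variable {k}

theorem induction_ofPath {P : PathAlgebra k V → Prop} (x : PathAlgebra k V)
    (path : ∀ p, P (ofPath k p)) (zero : P 0) (add : ∀ x y, P x → P y → P (x + y))
    (smul : ∀ (c : k) x, P x → P (c • x)) : P x := by
  have hx : x ∈ Submodule.span k (Set.range (pathBasis k V)) := by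
    rw [(pathBasis k V).span_eq]
    trivial
  induction hx using Submodule.span_induction with
  | mem y hy =>
    obtain ⟨p, rfl⟩ := hy
    exact path p
  | zero => exact zero
  | add y z _ _ hy hz => exact add y z hy hz
  | smul c y _ hy => exact smul c y hy

end Basis

section Mul

variable (k : Type u) [Field k] {V : Type v} [Quiver.{w} V] [DecidableEq V]

/-- The product `pq` of two paths: first follow `q`, then `p`, if the target of `q` is the source
of `p`; otherwise the product is zero. -/
def mulPath : QuiverPath V → QuiverPath V → PathAlgebra k V
  | ⟨b, c, p⟩, ⟨a, b', q⟩ => if h : b = b' then ofPath k ⟨a, c, (h ▸ q).comp p⟩ else 0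

variable (V) in
/-- The bilinear extension of the product of paths. -/
def mulLin : PathAlgebra k V →ₗ[k] PathAlgebra k V →ₗ[k] PathAlgebra k V :=
  (pathBasis k V).constr k fun p => (pathBasis k V).constr k fun q => mulPath k p q

instance : Mul (PathAlgebra k V) := ⟨fun x y => mulLin k V x y⟩

/-- The identity of the path algebra is the sum of all paths of length `0`. -/
instance [Fintype V] : One (PathAlgebra k V) :=
  ⟨∑ x : V, ofPath k ⟨x, x, Quiver.Path.nil⟩⟩

variable {k}

theorem ofPath_mul_ofPath (p q : QuiverPath V) : ofPath k p * ofPath k q = mulPath k p q := by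
  change mulLin k V (pathBasis k V p) (pathBasis k V q) = _
  simp [mulLin]

theorem ofPath_mul_ofPath_comp {a b c : V} (q : Quiver.Path a b) (p : Quiver.Path b c) :
    (ofPath k ⟨b, c, p⟩ : PathAlgebra k V) * ofPath k ⟨a, b, q⟩ = ofPath k ⟨a, c, q.comp p⟩ := by
  simp [ofPath_mul_ofPath, mulPath]

theorem ofPath_mul_ofPath_of_ne {a b b' c : V} (q : Quiver.Path a b') (p : Quiver.Path b c)
    (h : b ≠ b') : (ofPath k ⟨b, c, p⟩ : PathAlgebra k V) * ofPath k ⟨a, b', q⟩ = 0 := by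
  simp [ofPath_mul_ofPath, mulPath, h]

theorem mul_assoc_ofPath (p q r : QuiverPath V) :
    (ofPath k p * ofPath k q) * ofPath k r = ofPath k p * (ofPath k q * ofPath k r) := by
  have hz (x : PathAlgebra k V) : 0 * x = 0 := LinearMap.map_zero₂ (mulLin k V) x
  have hz' (x : PathAlgebra k V) : x * 0 = 0 := map_zero (mulLin k V x)
  obtain ⟨c, d, p⟩ := p
  obtain ⟨b, c', q⟩ := q
  obtain ⟨a, b', r⟩ := r
  by_cases h : c = c'
  · subst h
    by_cases h' : b = b'
    · subst h'
      simp [ofPath_mul_ofPath_comp]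
    · simp [ofPath_mul_ofPath_comp, ofPath_mul_ofPath_of_ne _ _ h', hz']
  · by_cases h' : b = b'
    · subst h'
      simp [ofPath_mul_ofPath_comp, ofPath_mul_ofPath_of_ne _ _ h, hz]
    · simp [ofPath_mul_ofPath_of_ne _ _ h, ofPath_mul_ofPath_of_ne _ _ h', hz, hz']

theorem mul_assoc' (x y z : PathAlgebra k V) : x * y * z = x * (y * z) := by
  have hadd (x y z : PathAlgebra k V) : (x + y) * z = x * z + y * z :=
    LinearMap.map_add₂ (mulLin k V) x y z
  have hadd' (x y z : PathAlgebra k V) : x * (y + z) = x * y + x * z :=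
    map_add (mulLin k V x) y z
  have hsmul (c : k) (x y : PathAlgebra k V) : (c • x) * y = c • (x * y) :=
    LinearMap.map_smul₂ (mulLin k V) c x y
  have hsmul' (c : k) (x y : PathAlgebra k V) : x * (c • y) = c • (x * y) :=
    map_smul (mulLin k V x) c y
  have hz (x : PathAlgebra k V) : 0 * x = 0 := LinearMap.map_zero₂ (mulLin k V) x
  have hz' (x : PathAlgebra k V) : x * 0 = 0 := map_zero (mulLin k V x)
  induction x using induction_ofPath with
  | zero => rw [hz, hz, hz]
  | add x x' hx hx' => rw [hadd, hadd, hadd, hx, hx']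
  | smul c x hx => rw [hsmul, hsmul, hsmul, hx]
  | path p =>
    induction y using induction_ofPath with
    | zero => rw [hz', hz, hz']
    | add y y' hy hy' => rw [hadd', hadd, hadd, hadd', hy, hy']
    | smul c y hy => rw [hsmul', hsmul, hsmul, hsmul', hy]
    | path q =>
      induction z using induction_ofPath with
      | zero => rw [hz', hz', hz']
      | add z z' hz hz' => rw [hadd', hadd', hadd', hz, hz']
      | smul c z hz => rw [hsmul', hsmul', hsmul', hz]
      | path r => exact mul_assoc_ofPath p q r

theorem one_mul' [Fintype V] (x : PathAlgebra k V) : 1 * x = x := by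
  have h : mulLin k V 1 = LinearMap.id := by
    refine (pathBasis k V).ext fun ⟨a, b, p⟩ => ?_
    have h1 : mulLin k V 1 = ∑ x : V, mulLin k V (ofPath k ⟨x, x, Quiver.Path.nil⟩) :=
      map_sum (mulLin k V) _ _
    rw [h1, LinearMap.sum_apply, Finset.sum_eq_single b]
    · exact ofPath_mul_ofPath_comp p Quiver.Path.nil
    · intro c _ hc
      exact ofPath_mul_ofPath_of_ne p Quiver.Path.nil hc
    · simp
  exact LinearMap.congr_fun h x

theorem mul_one' [Fintype V] (x : PathAlgebra k V) : x * 1 = x := by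
  have h : (mulLin k V).flip 1 = LinearMap.id := by
    refine (pathBasis k V).ext fun ⟨a, b, p⟩ => ?_
    have h1 : (mulLin k V).flip 1 =
        ∑ x : V, (mulLin k V).flip (ofPath k ⟨x, x, Quiver.Path.nil⟩) :=
      map_sum (mulLin k V).flip _ _
    rw [h1, LinearMap.sum_apply, Finset.sum_eq_single a]
    · have h2 := ofPath_mul_ofPath_comp (k := k) (Quiver.Path.nil : Quiver.Path a a) p
      rw [Quiver.Path.nil_comp] at h2
      exact h2
    · intro c _ hc
      exact ofPath_mul_ofPath_of_ne Quiver.Path.nil p (Ne.symm hc)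
    · simp
  exact LinearMap.congr_fun h x

instance [Fintype V] : Ring (PathAlgebra k V) :=
  { (inferInstance : AddCommGroup (PathAlgebra k V)),
    (inferInstance : Mul (PathAlgebra k V)),
    (inferInstance : One (PathAlgebra k V)) with
    left_distrib := fun x y z => map_add (mulLin k V x) y z
    right_distrib := fun x y z => LinearMap.map_add₂ (mulLin k V) x y z
    zero_mul := fun x => LinearMap.map_zero₂ (mulLin k V) x
    mul_zero := fun x => map_zero (mulLin k V x)
    mul_assoc := mul_assoc'
    one_mul := one_mul'
    mul_one := mul_one' }

instance [Fintype V] : Algebra k (PathAlgebra k V) :=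
  Algebra.ofModule (fun c x y => LinearMap.map_smul₂ (mulLin k V) c x y)
    (fun c x y => map_smul (mulLin k V x) c y)

variable (k V) in
/-- The span of the paths of positive length; it is a two-sided ideal `R` of `kΓ`. -/
def arrowIdeal : Submodule k (PathAlgebra k V) :=
  Submodule.span k {x | ∃ p : QuiverPath V, 0 < p.2.2.length ∧ x = ofPath k p}

/-- A two-sided ideal of `kΓ` is an ideal of relations if it is contained in `R²`
(equivalently, if it is generated by elements of `R²`). -/
def IsIdealOfRelations [Fintype V] (I : TwoSidedIdeal (PathAlgebra k V)) : Prop :=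
  ∀ x ∈ I, x ∈ arrowIdeal k V ^ 2

/-- The path algebra with relations `kΓ/I`. -/
abbrev WithRelations [Fintype V] (I : TwoSidedIdeal (PathAlgebra k V)) : Type (max u v w) :=
  I.ringCon.Quotient

end Mul

end PathAlgebra

/-- The quiver `V` has length `l`: `l` is the maximal length of its paths. -/
def Quiver.HasLength (V : Type v) [Quiver.{w} V] (l : ℕ) : Prop :=
  IsGreatest {n : ℕ | ∃ (a b : V) (p : Quiver.Path a b), p.length = n} l

/-- A quiver is ordered by a linear order on its vertices if every arrow goes from a smaller
vertex to a larger one. -/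
def Quiver.IsOrdered (V : Type v) [Quiver.{w} V] [LinearOrder V] : Prop :=
  ∀ (a b : V), (a ⟶ b) → a < b

/-- A quiver is connected if its underlying unoriented graph is: it is nonempty, and any two
vertices are joined by a zigzag of arrows. -/
def Quiver.IsConnected (V : Type v) [Quiver.{w} V] : Prop :=
  Nonempty V ∧ Subsingleton (Quiver.WeaklyConnectedComponent V)

/-! ### The Serre bimodule and underived tensor powers of bimodules -/

/-- The Serre bimodule `A^* = Hom_k(A, k)` of the `k`-algebra `A`. -/
def SerreBimodule (k : Type u) [Field k] (A : Type v) [Ring A] [Algebra k A] : Type (max u v) :=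
  A →ₗ[k] k

namespace SerreBimodule

variable (k : Type u) [Field k] (A : Type v) [Ring A] [Algebra k A]

instance : AddCommGroup (SerreBimodule k A) := inferInstanceAs (AddCommGroup (A →ₗ[k] k))

instance : Module k (SerreBimodule k A) := inferInstanceAs (Module k (A →ₗ[k] k))

instance : FunLike (SerreBimodule k A) A k := inferInstanceAs (FunLike (A →ₗ[k] k) A k)

/-- The left action of `A` on `A^*`: `(a f)(x) = f(x a)`. -/
instance : Module A (SerreBimodule k A) where
  smul a f := LinearMap.comp (f : A →ₗ[k] k) (LinearMap.mulRight k a)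
  one_smul f := DFunLike.ext _ _ fun x => congrArg f (mul_one x)
  mul_smul a b f := DFunLike.ext _ _ fun x => congrArg f (mul_assoc x a b).symm
  smul_zero _ := rfl
  smul_add _ _ _ := rfl
  add_smul a b f := DFunLike.ext _ _ fun x =>
    (congrArg f (mul_add x a b)).trans (LinearMap.map_add (f : A →ₗ[k] k) _ _)
  zero_smul f := DFunLike.ext _ _ fun x =>
    (congrArg f (mul_zero x)).trans (LinearMap.map_zero (f : A →ₗ[k] k))

/-- The right action of `A` on `A^*`: `(f b)(x) = f(b x)`. -/
instance : Module Aᵐᵒᵖ (SerreBimodule k A) where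
  smul b f := LinearMap.comp (f : A →ₗ[k] k) (LinearMap.mulLeft k b.unop)
  one_smul f := DFunLike.ext _ _ fun x => congrArg f (one_mul x)
  mul_smul a b f := DFunLike.ext _ _ fun x => congrArg f (mul_assoc b.unop a.unop x)
  smul_zero _ := rfl
  smul_add _ _ _ := rfl
  add_smul a b f := DFunLike.ext _ _ fun x =>
    (congrArg f (add_mul a.unop b.unop x)).trans (LinearMap.map_add (f : A →ₗ[k] k) _ _)
  zero_smul f := DFunLike.ext _ _ fun x =>
    (congrArg f (zero_mul x)).trans (LinearMap.map_zero (f : A →ₗ[k] k))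

variable {k A}

theorem smul_apply (a : A) (f : SerreBimodule k A) (x : A) : (a • f) x = f (x * a) := rfl

theorem op_smul_apply (b : A) (f : SerreBimodule k A) (x : A) :
    (MulOpposite.op b • f) x = f (b * x) := rfl

end SerreBimodule

section TensorPower

variable (k : Type u) [Field k] (A : Type v) [Ring A]
  (B : Type w) [AddCommGroup B] [Module k B] [Module A B] [Module Aᵐᵒᵖ B]

/-- For an `A`-bimodule `B`, the subspace of the `r`-fold tensor power of `B` over `k` spanned by
the elements `… ⊗ fᵢ a ⊗ fᵢ₊₁ ⊗ … - … ⊗ fᵢ ⊗ a fᵢ₊₁ ⊗ …`. -/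
def balancedRelations (r : ℕ) : Submodule k (PiTensorProduct k fun _ : Fin r => B) :=
  Submodule.span k {t | ∃ (f : Fin r → B) (i j : Fin r) (a : A), (j : ℕ) = i + 1 ∧
    t = PiTensorProduct.tprod k (Function.update f i (MulOpposite.op a • f i)) -
      PiTensorProduct.tprod k (Function.update f j (a • f j))}

/-- The `r`-fold underived tensor power `B ⊗_A ⋯ ⊗_A B` of an `A`-bimodule `B`, for `r ≥ 1`. -/
abbrev BimoduleTensorPower (r : ℕ) : Type _ :=
  (PiTensorProduct k fun _ : Fin r => B) ⧸ balancedRelations k A B r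

end TensorPower

/-! ### Perfect complexes, Serre functors and the lower Serre dimension -/

section Perf

variable (A : Type v) [Ring A] [HasDerivedCategory.{u'} (ModuleCat.{v} Aᵐᵒᵖ)]

/-- An object of the derived category `D(A)` of right `A`-modules is perfect if it is isomorphic
there to a bounded complex of finitely generated projective modules. -/
def isPerfect : ObjectProperty (DerivedCategory (ModuleCat.{v} Aᵐᵒᵖ)) := fun X =>
  ∃ K : CochainComplex (ModuleCat.{v} Aᵐᵒᵖ) ℤ,
    (∃ a b : ℤ, ∀ i : ℤ, i < a ∨ b < i → Limits.IsZero (K.X i)) ∧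
    (∀ i : ℤ, Module.Finite Aᵐᵒᵖ (K.X i) ∧ Module.Projective Aᵐᵒᵖ (K.X i)) ∧
    Nonempty (X ≅ DerivedCategory.Q.obj K)

/-- The category `Perf A`, a full subcategory of the derived category of right `A`-modules. -/
abbrev Perf := (isPerfect A).FullSubcategory

variable {A}

/-- `G` is a classical generator of `Perf A`: every perfect complex is obtained from `G` by
finitely many shifts, finite direct sums, extensions and direct summands. -/
def IsClassicalGenerator (G : Perf A) : Prop :=
  ∀ X : Perf A, (ObjectProperty.singleton G.obj).triangEnvelope X.obj

/-- `sup Hom^•(X, Y)`, the supremum (in `[-∞, ∞]`) of the integers `i` with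
`Hom(X, Y[i]) ≠ 0`. -/
def supHom (X Y : Perf A) : EReal :=
  sSup {t : EReal | ∃ i : ℤ, Nontrivial (X.obj ⟶ (shiftFunctor _ i).obj Y.obj) ∧
    t = ((i : ℝ) : EReal)}

/-- The lower Serre dimension of `Perf A`, computed with the Serre functor `S` and the classical
generator `G`: the lower limit of `- sup Hom^•(G, S^m G) / m`. -/
def LSdim (S : Perf A ⥤ Perf A) (G : Perf A) : EReal :=
  liminf (fun m : ℕ => -supHom G (S.obj^[m] G) / (m : EReal)) atTop

end Perf

/-- A Serre functor on a `k`-linear category `T`: a functor `S` together with isomorphisms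
`Hom(X, Y) ≅ Hom(Y, S X)^*` of `k`-vector spaces, natural in `X` and `Y`. -/
structure SerreFunctor (k : Type u) [Field k] (T : Type v) [Category.{w} T] [Preadditive T]
    [Linear k T] where
  /-- the underlying functor -/
  functor : T ⥤ T
  /-- the duality isomorphisms -/
  duality (X Y : T) : (X ⟶ Y) ≃ₗ[k] Module.Dual k (Y ⟶ functor.obj X)
  /-- naturality in the first variable -/
  naturality_left {X X' Y : T} (f : X' ⟶ X) (g : X ⟶ Y) (h : Y ⟶ functor.obj X') :
    duality X' Y (f ≫ g) h = duality X Y g (h ≫ functor.map f)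
  /-- naturality in the second variable -/
  naturality_right {X Y Y' : T} (f : X ⟶ Y) (g : Y ⟶ Y') (h : Y' ⟶ functor.obj X) :
    duality X Y' (f ≫ g) h = duality X Y f (g ≫ h)

end


/-! Write `A` for the algebra. Evaluation at the unit identifies the dual of `Hom(e_i A, Y)` with
`Hom(Y, e_i A^*)`, so the indecomposable projectives have Serre duals. These are perfect, because
the vertices are ordered and hence every finite-dimensional module has a finite projective
resolution. Serre duals pass to shifts, extensions and summands, which gives the Serre functor `S`.

By Serre duality `Hom(A, S X)` is dual to `Hom(X, A)`, so `S` preserves the aisles `D^{≤ n}` of the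
standard t-structure. On the top cohomology it acts as `- ⊗_A A^*`: if the `r`-fold tensor power of
`A^*` vanishes, then `S^r` maps `D^{≤ n}` into `D^{≤ n - 1}`, and so `LSdim ≥ 1 / r`.

For the vanishing with `r = l + 2`, call the maximal length of a path ending at a vertex its depth,
and move a vertex idempotent `e_i` through the tensor factors from left to right. If an arrow starts
at `i`, then `e_i A^*` lies in the sum of the `A^* e_j A` over the `j` of larger depth, so the next
factor may be assumed to lie in `e_j A^*`. If `i` is a sink, it is the target of an arrow `a`, and
every element of `e_i A^*` is fixed by `e_i` and annihilated by `a` on the right, and divisible by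
`a` on the left. Hence `f ⊗ f' = f ⊗ e_i f' = f ⊗ a h = f a ⊗ h = 0` for `f` in `e_i A^*`. The depth
is at most `l`, so this happens before the last factor. -/

noncomputable section

open Limits Pretriangulated ZeroObject MulOpposite

/-! ### Serre duals in linear triangulated categories -/

section LinearAlgebra

variable {k : Type*} [Field k] {M M₁ M₂ M₃ : Type*} [AddCommGroup M] [Module k M]
  [AddCommGroup M₁] [Module k M₁] [AddCommGroup M₂] [Module k M₂] [AddCommGroup M₃] [Module k M₃]

theorem exists_dual_comp_eq (L : M₁ →ₗ[k] M₂) (f : Module.Dual k M₁)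
    (h : LinearMap.ker L ≤ LinearMap.ker f) : ∃ g : Module.Dual k M₂, g ∘ₗ L = f := by
  change f ∈ LinearMap.range L.dualMap
  rw [LinearMap.range_dualMap_eq_dualAnnihilator_ker, Submodule.mem_dualAnnihilator]
  exact h

theorem exact_dualMap {f : M₁ →ₗ[k] M₂} {g : M₂ →ₗ[k] M₃} (h : Function.Exact f g) :
    Function.Exact g.dualMap f.dualMap := by
  rw [LinearMap.exact_iff] at h ⊢
  rw [LinearMap.ker_dualMap_eq_dualAnnihilator_range,
    LinearMap.range_dualMap_eq_dualAnnihilator_ker, h]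

theorem bijective_neg {f : M₁ →ₗ[k] M₂} (h : Function.Bijective f) : Function.Bijective (-f) :=
  (Equiv.neg M₂).bijective.comp h

end LinearAlgebra

section SerreDual

variable {k : Type u} [Field k] {T : Type v} [Category.{w} T] [Preadditive T] [Linear k T]

/-- The pairing `Hom(Y, Z) → Hom(X, Y)^*` induced by a functional on `Hom(X, Z)`. It is bijective
for all `Y` if and only if `Z`, with this functional, represents `Hom(X, -)^*`. -/
def serrePairing {X Z : T} (φ : (X ⟶ Z) →ₗ[k] k) (Y : T) : (Y ⟶ Z) →ₗ[k] Module.Dual k (X ⟶ Y) :=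
  ((Linear.comp X Y Z : (X ⟶ Y) →ₗ[k] (Y ⟶ Z) →ₗ[k] (X ⟶ Z)).flip).compr₂ φ

@[simp]
theorem serrePairing_apply {X Y Z : T} (φ : (X ⟶ Z) →ₗ[k] k) (h : Y ⟶ Z) (g : X ⟶ Y) :
    serrePairing φ Y h g = φ (g ≫ h) := rfl

theorem serrePairing_bijective_of_iso {X Z Y Y' : T} (φ : (X ⟶ Z) →ₗ[k] k) (e : Y ≅ Y')
    (h : Function.Bijective (serrePairing φ Y)) : Function.Bijective (serrePairing φ Y') := by
  have : serrePairing φ Y' = ((Linear.homCongr k (Iso.refl X) e).symm.dualMap.toLinearMap) ∘ₗ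
      serrePairing φ Y ∘ₗ (Linear.homCongr k e (Iso.refl Z)).symm.toLinearMap := by
    ext f g
    simp [Linear.homCongr_symm_apply]
  rw [this, LinearMap.coe_comp, LinearMap.coe_comp]
  exact (LinearEquiv.bijective _).comp (h.comp (LinearEquiv.bijective _))

variable (k) in
/-- `X` has a Serre dual in `P` if the functor `Hom(X, -)^*` on `P` is represented by an object
of `P`. The object `X` itself need not belong to `P`. -/
def HasSerreDual (P : ObjectProperty T) : ObjectProperty T := fun X =>
  ∃ (Z : T) (φ : (X ⟶ Z) →ₗ[k] k), P Z ∧ ∀ Y, P Y → Function.Bijective (serrePairing φ Y)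

instance (P : ObjectProperty T) : (HasSerreDual k P).IsClosedUnderIsomorphisms where
  of_iso := by
    rintro X X' e ⟨Z, φ, hZ, h⟩
    refine ⟨Z, φ ∘ₗ (Linear.homCongr k e (Iso.refl Z)).symm.toLinearMap, hZ, fun Y hY => ?_⟩
    have : serrePairing (φ ∘ₗ (Linear.homCongr k e (Iso.refl Z)).symm.toLinearMap) Y =
        ((Linear.homCongr k e (Iso.refl Y)).symm.dualMap.toLinearMap) ∘ₗ serrePairing φ Y := by
      ext f g
      simp [Linear.homCongr_symm_apply]
    rw [this, LinearMap.coe_comp]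
    exact (LinearEquiv.bijective _).comp (h Y hY)

section FullyFaithful

variable {T' : Type*} [Category T'] [Preadditive T'] [Linear k T'] (F : T ⥤ T')
  [F.Additive] [F.Linear k] [F.Full] [F.Faithful]

variable (k) in
/-- The linear equivalence between spaces of morphisms induced by a fully faithful linear
functor. -/
def homLinearEquivOfFullyFaithful (X Y : T) : (X ⟶ Y) ≃ₗ[k] (F.obj X ⟶ F.obj Y) :=
  LinearEquiv.ofBijective (F.mapLinearMap k) ⟨F.map_injective, F.map_surjective⟩

/-- A functional on `Hom(X, Z)`, transported by a fully faithful functor. -/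
def mapFunctional {X Z : T} (φ : (X ⟶ Z) →ₗ[k] k) : (F.obj X ⟶ F.obj Z) →ₗ[k] k :=
  φ ∘ₗ (homLinearEquivOfFullyFaithful k F X Z).symm.toLinearMap

@[simp]
theorem mapFunctional_map {X Z : T} (φ : (X ⟶ Z) →ₗ[k] k) (f : X ⟶ Z) :
    mapFunctional F φ (F.map f) = φ f :=
  congrArg φ ((homLinearEquivOfFullyFaithful k F X Z).symm_apply_apply f)

theorem mapFunctional_comp {X X' Z Z' : T} {u : X ⟶ X'} {s : Z ⟶ Z'} {φ : (X ⟶ Z) →ₗ[k] k}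
    {φ' : (X' ⟶ Z') →ₗ[k] k} (h : ∀ g : X' ⟶ Z, φ' (g ≫ s) = φ (u ≫ g))
    (g : F.obj X' ⟶ F.obj Z) :
    mapFunctional F φ' (g ≫ F.map s) = mapFunctional F φ (F.map u ≫ g) := by
  obtain ⟨g, rfl⟩ := F.map_surjective g
  rw [← F.map_comp, ← F.map_comp, mapFunctional_map, mapFunctional_map, h]

theorem serrePairing_comp_mapLinearMap_bijective_iff {X Y Z : T}
    (φ : (F.obj X ⟶ F.obj Z) →ₗ[k] k) :
    Function.Bijective (serrePairing (φ ∘ₗ F.mapLinearMap k) Y) ↔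
      Function.Bijective (serrePairing φ (F.obj Y)) := by
  have : serrePairing (φ ∘ₗ F.mapLinearMap k) Y =
      (homLinearEquivOfFullyFaithful k F X Y).dualMap.toLinearMap ∘ₗ serrePairing φ (F.obj Y) ∘ₗ
        (homLinearEquivOfFullyFaithful k F Y Z).toLinearMap := by
    ext f g
    exact congrArg φ (F.map_comp g f)
  rw [this, LinearMap.coe_comp, LinearMap.coe_comp]
  exact (Function.Bijective.of_comp_iff' (LinearEquiv.bijective _) _).trans
    (Function.Bijective.of_comp_iff _ (LinearEquiv.bijective _))

theorem serrePairing_mapFunctional_bijective {X Y Z : T} (φ : (X ⟶ Z) →ₗ[k] k)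
    (h : Function.Bijective (serrePairing φ Y)) :
    Function.Bijective (serrePairing (mapFunctional F φ) (F.obj Y)) := by
  rw [← serrePairing_comp_mapLinearMap_bijective_iff]
  convert h
  exact LinearMap.ext (mapFunctional_map F φ)

end FullyFaithful

section SerreFunctorOfDuals

variable {Z : T → T} (φ : ∀ X, (X ⟶ Z X) →ₗ[k] k)
  (hφ : ∀ X Y, Function.Bijective (serrePairing (φ X) Y))

/-- The action on morphisms of the functor assembled from Serre duals `Z X` of all objects: the
morphism `s` with `φ(g s) = φ(f g)` for all `g`. -/
def serreDualMap {X X' : T} (f : X ⟶ X') : Z X ⟶ Z X' :=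
  (LinearEquiv.ofBijective _ (hφ X' (Z X))).symm (φ X ∘ₗ Linear.leftComp k _ f)

theorem functional_comp_serreDualMap {X X' : T} (f : X ⟶ X') (g : X' ⟶ Z X) :
    φ X' (g ≫ serreDualMap φ hφ f) = φ X (f ≫ g) :=
  LinearMap.congr_fun
    ((LinearEquiv.ofBijective _ (hφ X' (Z X))).apply_symm_apply (φ X ∘ₗ Linear.leftComp k _ f)) g

/-- The functor assembled from Serre duals of all objects. -/
@[simps]
def serreDualFunctor : T ⥤ T where
  obj := Z
  map := serreDualMap φ hφ
  map_id X := (hφ X _).1 <| LinearMap.ext fun g => by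
    simp [functional_comp_serreDualMap]
  map_comp {X X' X''} f g := (hφ X'' _).1 <| LinearMap.ext fun h => by
    rw [serrePairing_apply, serrePairing_apply, functional_comp_serreDualMap, ← Category.assoc h,
      functional_comp_serreDualMap, ← Category.assoc g, functional_comp_serreDualMap,
      Category.assoc]

/-- Serre duals of all objects of a Hom-finite category form a Serre functor; finiteness is needed
to dualize the isomorphisms `Hom(Y, Z X) ≅ Hom(X, Y)^*`. -/
def serreFunctorOfDuals [∀ X Y : T, FiniteDimensional k (X ⟶ Y)] : SerreFunctor k T where
  functor := serreDualFunctor φ hφ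
  duality X Y := .ofBijective (serrePairing (φ X) Y).flip
    (LinearMap.IsPerfPair.of_bijective _ (hφ X Y)).bijective_right
  naturality_left {X X' Y} f g (h : Y ⟶ Z X') := by
    change φ _ ((f ≫ g) ≫ h) = φ _ (g ≫ h ≫ serreDualMap φ hφ f)
    rw [← Category.assoc g, functional_comp_serreDualMap, Category.assoc]
  naturality_right f g h := congrArg (φ _) (Category.assoc f g h)

end SerreFunctorOfDuals

theorem nonempty_serreFunctor (P : ObjectProperty T) (hP : P ≤ HasSerreDual k P)
    (hfin : ∀ X Y, P X → P Y → FiniteDimensional k (X ⟶ Y)) :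
    Nonempty (SerreFunctor k P.FullSubcategory) := by
  choose Z φ hZ hφ using hP
  have (X Y : P.FullSubcategory) : FiniteDimensional k (X ⟶ Y) :=
    have : FiniteDimensional k (P.ι.obj X ⟶ P.ι.obj Y) := hfin _ _ X.property Y.property
    (homLinearEquivOfFullyFaithful k P.ι X Y).symm.finiteDimensional
  exact ⟨serreFunctorOfDuals (Z := fun X => ⟨Z X.obj X.property, hZ _ _⟩)
    (fun X => φ X.obj X.property ∘ₗ P.ι.mapLinearMap k)
    fun X Y => (serrePairing_comp_mapLinearMap_bijective_iff P.ι _).2 (hφ _ _ _ Y.property)⟩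

section Shift

variable [HasShift T ℤ]

/-- The objects on all shifts of which the pairing given by a functional is perfect; the shifts
make it a triangulated subcategory. -/
def serrePairingPerfect {X Z : T} (φ : (X ⟶ Z) →ₗ[k] k) : ObjectProperty T := fun Y =>
  ∀ n : ℤ, Function.Bijective (serrePairing φ (Y⟦n⟧))

instance {X Z : T} (φ : (X ⟶ Z) →ₗ[k] k) :
    (serrePairingPerfect φ).IsClosedUnderIsomorphisms where
  of_iso e h n := serrePairing_bijective_of_iso φ ((shiftFunctor T n).mapIso e) (h n)

instance {X Z : T} (φ : (X ⟶ Z) →ₗ[k] k) : (serrePairingPerfect φ).IsStableUnderShift ℤ where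
  isStableUnderShiftBy n :=
    { le_shift := fun Y hY m => serrePairing_bijective_of_iso φ ((shiftFunctorAdd T n m).app Y)
        (hY (n + m)) }

theorem serrePairingPerfect.bijective {X Z : T} {φ : (X ⟶ Z) →ₗ[k] k} {Y : T}
    (hY : serrePairingPerfect φ Y) : Function.Bijective (serrePairing φ Y) :=
  serrePairing_bijective_of_iso φ ((shiftFunctorZero T ℤ).app Y) (hY 0)

variable [∀ n : ℤ, (shiftFunctor T n).Additive] [∀ n : ℤ, (shiftFunctor T n).Linear k]

theorem serrePairing_shift_bijective {P : ObjectProperty T} [P.IsStableUnderShift ℤ] {X Z : T}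
    {φ : (X ⟶ Z) →ₗ[k] k} (hφ : ∀ Y, P Y → Function.Bijective (serrePairing φ Y)) (n : ℤ) {Y : T}
    (hY : P Y) : Function.Bijective (serrePairing (mapFunctional (shiftFunctor T n) φ) Y) :=
  serrePairing_bijective_of_iso _ ((shiftEquiv T n).counitIso.app Y)
    (serrePairing_mapFunctional_bijective _ _ (hφ _ (P.le_shift (-n) _ hY)))

instance (P : ObjectProperty T) [P.IsStableUnderShift ℤ] :
    (HasSerreDual k P).IsStableUnderShift ℤ where
  isStableUnderShiftBy n :=
    { le_shift := by
        rintro X ⟨Z, φ, hZ, hφ⟩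
        exact ⟨Z⟦n⟧, mapFunctional (shiftFunctor T n) φ, P.le_shift n _ hZ,
          fun Y hY => serrePairing_shift_bijective hφ n hY⟩ }

end Shift

section Triangulated

variable [HasZeroObject T] [HasShift T ℤ] [∀ n : ℤ, (shiftFunctor T n).Additive]
  [Pretriangulated T] {Δ : Triangle T}

section Exactness

variable (hΔ : Δ ∈ distTriang T) (W : T)
include hΔ

theorem exact_rightComp_mor₂ :
    Function.Exact (Linear.rightComp k W Δ.mor₁) (Linear.rightComp k W Δ.mor₂) := by
  refine fun f => ⟨fun hf => ?_, ?_⟩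
  · obtain ⟨g, rfl⟩ := Triangle.coyoneda_exact₂ Δ hΔ f hf
    exact ⟨g, rfl⟩
  · rintro ⟨g, rfl⟩
    simp [comp_distTriang_mor_zero₁₂ Δ hΔ]

theorem exact_leftComp_mor₁ :
    Function.Exact (Linear.leftComp k W Δ.mor₂) (Linear.leftComp k W Δ.mor₁) := by
  refine fun f => ⟨fun hf => ?_, ?_⟩
  · obtain ⟨g, rfl⟩ := Triangle.yoneda_exact₂ Δ hΔ f hf
    exact ⟨g, rfl⟩
  · rintro ⟨g, rfl⟩
    simp [comp_distTriang_mor_zero₁₂_assoc Δ hΔ]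

theorem exact_rightComp_mor₃ :
    Function.Exact (Linear.rightComp k W Δ.mor₂) (Linear.rightComp k W Δ.mor₃) :=
  exact_rightComp_mor₂ (rot_of_distTriang Δ hΔ) W

theorem exact_leftComp_mor₂ :
    Function.Exact (Linear.leftComp k W Δ.mor₃) (Linear.leftComp k W Δ.mor₂) :=
  exact_leftComp_mor₁ (rot_of_distTriang Δ hΔ) W

theorem exact_rightComp_shift :
    Function.Exact (Linear.rightComp k W Δ.mor₃) (Linear.rightComp k W (Δ.mor₁⟦(1 : ℤ)⟧')) := by
  intro f
  refine Iff.trans ?_ (exact_rightComp_mor₃ (k := k) (rot_of_distTriang Δ hΔ) W f)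
  change f ≫ _ = 0 ↔ f ≫ (-Δ.mor₁⟦(1 : ℤ)⟧') = 0
  rw [Preadditive.comp_neg, neg_eq_zero]

theorem exact_leftComp_shift :
    Function.Exact (Linear.leftComp k W (Δ.mor₁⟦(1 : ℤ)⟧')) (Linear.leftComp k W Δ.mor₃) := by
  refine fun f => (exact_leftComp_mor₂ (k := k) (rot_of_distTriang Δ hΔ) W f).trans ⟨?_, ?_⟩
  · rintro ⟨g, rfl⟩
    exact ⟨-g, (Preadditive.comp_neg _ _).trans (Preadditive.neg_comp _ _).symm⟩
  · rintro ⟨g, rfl⟩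
    exact ⟨-g, Preadditive.neg_comp_neg _ _⟩

end Exactness

theorem serrePairing_bijective_of_distTriang {X Z : T} (φ : (X ⟶ Z) →ₗ[k] k)
    (hΔ : Δ ∈ distTriang T) (h₁ : serrePairingPerfect φ Δ.obj₁)
    (h₂ : serrePairingPerfect φ Δ.obj₂) : Function.Bijective (serrePairing φ Δ.obj₃) := by
  refine LinearMap.bijective_of_surjective_of_bijective_of_bijective_of_injective
    (Linear.leftComp k Z (Δ.mor₁⟦(1 : ℤ)⟧'))
    (Linear.leftComp k Z Δ.mor₃) (Linear.leftComp k Z Δ.mor₂) (Linear.leftComp k Z Δ.mor₁)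
    (Linear.rightComp k X (Δ.mor₁⟦(1 : ℤ)⟧')).dualMap
    (Linear.rightComp k X Δ.mor₃).dualMap (Linear.rightComp k X Δ.mor₂).dualMap
    (Linear.rightComp k X Δ.mor₁).dualMap
    (serrePairing φ _) (serrePairing φ _) (serrePairing φ _) (serrePairing φ _)
    (serrePairing φ _) ?_ ?_ ?_ ?_ (exact_leftComp_shift hΔ Z) (exact_leftComp_mor₂ hΔ Z)
    (exact_leftComp_mor₁ hΔ Z) (exact_dualMap (exact_rightComp_shift hΔ X))
    (exact_dualMap (exact_rightComp_mor₃ hΔ X)) (exact_dualMap (exact_rightComp_mor₂ hΔ X))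
    (h₂ 1).2 (h₁ 1) h₂.bijective h₁.bijective.1
  all_goals
    ext f g
    simp

instance {X Z : T} (φ : (X ⟶ Z) →ₗ[k] k) : (serrePairingPerfect φ).IsTriangulated :=
  have : (serrePairingPerfect φ).IsTriangulatedClosed₃ :=
    .mk' fun Δ hΔ h₁ h₂ n => serrePairing_bijective_of_distTriang φ
      (Triangle.shift_distinguished Δ hΔ n)
      ((serrePairingPerfect φ).le_shift n _ h₁) ((serrePairingPerfect φ).le_shift n _ h₂)
  { exists_zero := by
      refine ⟨0, isZero_zero T, fun n => ?_⟩
      have h0 : IsZero ((0 : T)⟦n⟧) := (shiftFunctor T n).map_isZero (isZero_zero T)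
      refine ⟨fun f g _ => h0.eq_of_src _ _, fun f => ⟨0, ?_⟩⟩
      ext g
      rw [h0.eq_of_tgt g 0, map_zero, map_zero]
    toIsTriangulatedClosed₂ := .of_isTriangulatedClosed₃ }

section DualCone

variable [∀ n : ℤ, (shiftFunctor T n).Linear k]

variable {Δ' : Triangle T} {φ₁ : (Δ.obj₁ ⟶ Δ'.obj₁) →ₗ[k] k} {φ₂ : (Δ.obj₂ ⟶ Δ'.obj₂) →ₗ[k] k}

theorem functional_add_eq_zero_of_distTriang (hΔ : Δ ∈ distTriang T) (hΔ' : Δ' ∈ distTriang T)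
    (h : ∀ g : Δ.obj₂ ⟶ Δ'.obj₁, φ₂ (g ≫ Δ'.mor₁) = φ₁ (Δ.mor₁ ≫ g))
    {a : Δ.obj₃ ⟶ Δ'.obj₂} {b : Δ.obj₁⟦(1 : ℤ)⟧ ⟶ Δ'.obj₃}
    (hab : a ≫ Δ'.mor₂ + Δ.mor₃ ≫ b = 0) :
    φ₂ (Δ.mor₂ ≫ a) - mapFunctional (shiftFunctor T (1 : ℤ)) φ₁ (b ≫ Δ'.mor₃) = 0 := by
  -- `hab` is a commutative square between the rotated triangles; complete it to a morphism.
  obtain ⟨c, hcb, hca⟩ : ∃ c : Δ.obj₂⟦(1 : ℤ)⟧ ⟶ Δ'.obj₁⟦(1 : ℤ)⟧,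
      (-Δ.mor₁⟦(1 : ℤ)⟧') ≫ c = b ≫ Δ'.mor₃ ∧
      (-Δ.mor₂⟦(1 : ℤ)⟧') ≫ (-a)⟦(1 : ℤ)⟧' = c ≫ (-Δ'.mor₁⟦(1 : ℤ)⟧') :=
    complete_distinguished_triangle_morphism _ _
      (rot_of_distTriang _ (rot_of_distTriang _ hΔ)) (rot_of_distTriang _ hΔ') (-a) b
      ((eq_neg_of_add_eq_zero_right hab).trans (Preadditive.neg_comp _ _).symm)
  obtain ⟨c, rfl⟩ := (shiftFunctor T (1 : ℤ)).map_surjective c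
  have hca : Δ.mor₂ ≫ a = - (c ≫ Δ'.mor₁) := by
    apply (shiftFunctor T (1 : ℤ)).map_injective
    simpa using hca
  rw [hca, ← hcb, map_neg, h, Preadditive.neg_comp, ← Functor.map_comp, map_neg,
    mapFunctional_map, sub_neg_eq_add, neg_add_cancel]

theorem exists_functional_of_distTriang (hΔ : Δ ∈ distTriang T) (hΔ' : Δ' ∈ distTriang T)
    (h : ∀ g : Δ.obj₂ ⟶ Δ'.obj₁, φ₂ (g ≫ Δ'.mor₁) = φ₁ (Δ.mor₁ ≫ g)) :
    ∃ ψ : (Δ.obj₃ ⟶ Δ'.obj₃) →ₗ[k] k,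
      (∀ g : Δ.obj₃ ⟶ Δ'.obj₂, ψ (g ≫ Δ'.mor₂) = φ₂ (Δ.mor₂ ≫ g)) ∧
      (∀ g : Δ.obj₁⟦(1 : ℤ)⟧ ⟶ Δ'.obj₃, ψ (Δ.mor₃ ≫ g) =
        - mapFunctional (shiftFunctor T (1 : ℤ)) φ₁ (g ≫ Δ'.mor₃)) := by
  obtain ⟨ψ, hψ⟩ := exists_dual_comp_eq
    ((Linear.rightComp k Δ.obj₃ Δ'.mor₂).coprod (Linear.leftComp k Δ'.obj₃ Δ.mor₃))
    ((φ₂ ∘ₗ Linear.leftComp k Δ'.obj₂ Δ.mor₂).coprod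
      (-(mapFunctional (shiftFunctor T (1 : ℤ)) φ₁ ∘ₗ Linear.rightComp k _ Δ'.mor₃)))
    fun ⟨a, b⟩ hab => (sub_eq_add_neg _ _).symm.trans
      (functional_add_eq_zero_of_distTriang hΔ hΔ' h hab)
  refine ⟨ψ, fun g => ?_, fun g => ?_⟩
  · simpa using LinearMap.congr_fun hψ (g, 0)
  · simpa using LinearMap.congr_fun hψ (0, g)

theorem serrePairing_bijective_of_functional_of_distTriang (hΔ : Δ ∈ distTriang T)
    (hΔ' : Δ' ∈ distTriang T)
    (h : ∀ g : Δ.obj₂ ⟶ Δ'.obj₁, φ₂ (g ≫ Δ'.mor₁) = φ₁ (Δ.mor₁ ≫ g))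
    {ψ : (Δ.obj₃ ⟶ Δ'.obj₃) →ₗ[k] k}
    (hψ₂ : ∀ g : Δ.obj₃ ⟶ Δ'.obj₂, ψ (g ≫ Δ'.mor₂) = φ₂ (Δ.mor₂ ≫ g))
    (hψ₁ : ∀ g : Δ.obj₁⟦(1 : ℤ)⟧ ⟶ Δ'.obj₃, ψ (Δ.mor₃ ≫ g) =
      - mapFunctional (shiftFunctor T (1 : ℤ)) φ₁ (g ≫ Δ'.mor₃))
    {P : ObjectProperty T} [P.IsStableUnderShift ℤ]
    (hφ₁ : ∀ Y, P Y → Function.Bijective (serrePairing φ₁ Y))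
    (hφ₂ : ∀ Y, P Y → Function.Bijective (serrePairing φ₂ Y)) {W : T} (hW : P W) :
    Function.Bijective (serrePairing ψ W) := by
  refine LinearMap.bijective_of_surjective_of_bijective_of_bijective_of_injective
    (Linear.rightComp k W Δ'.mor₁) (Linear.rightComp k W Δ'.mor₂) (Linear.rightComp k W Δ'.mor₃)
    (Linear.rightComp k W (Δ'.mor₁⟦(1 : ℤ)⟧'))
    (Linear.leftComp k W Δ.mor₁).dualMap (Linear.leftComp k W Δ.mor₂).dualMap
    (Linear.leftComp k W Δ.mor₃).dualMap (Linear.leftComp k W (Δ.mor₁⟦(1 : ℤ)⟧')).dualMap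
    (serrePairing φ₁ W) (serrePairing φ₂ W) (serrePairing ψ W)
    (-serrePairing (mapFunctional (shiftFunctor T (1 : ℤ)) φ₁) W)
    (-serrePairing (mapFunctional (shiftFunctor T (1 : ℤ)) φ₂) W)
    ?_ ?_ ?_ ?_ (exact_rightComp_mor₂ hΔ' W) (exact_rightComp_mor₃ hΔ' W)
    (exact_rightComp_shift hΔ' W)
    (exact_dualMap (exact_leftComp_mor₁ hΔ W)) (exact_dualMap (exact_leftComp_mor₂ hΔ W))
    (exact_dualMap (exact_leftComp_shift hΔ W))
    (hφ₁ W hW).2 (hφ₂ W hW) (bijective_neg (serrePairing_shift_bijective hφ₁ 1 hW))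
    (bijective_neg (serrePairing_shift_bijective hφ₂ 1 hW)).1
  · ext f g
    simp [← h]
  · ext f g
    simp [← hψ₂]
  · ext f g
    simp [hψ₁]
  · ext f g
    simpa using (mapFunctional_comp (shiftFunctor T (1 : ℤ)) h (g ≫ f)).symm

theorem hasSerreDual_of_distTriang (P : ObjectProperty T) [P.IsTriangulated]
    [P.IsClosedUnderIsomorphisms] (hΔ : Δ ∈ distTriang T)
    (h₁ : HasSerreDual k P Δ.obj₁) (h₂ : HasSerreDual k P Δ.obj₂) : HasSerreDual k P Δ.obj₃ := by
  obtain ⟨Z₁, φ₁, hZ₁, hφ₁⟩ := h₁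
  obtain ⟨Z₂, φ₂, hZ₂, hφ₂⟩ := h₂
  obtain ⟨s, hs⟩ := (hφ₂ Z₁ hZ₁).2 (φ₁ ∘ₗ Linear.leftComp k _ Δ.mor₁)
  obtain ⟨C, q, r, hΔ'⟩ := distinguished_cocone_triangle s
  obtain ⟨ψ, hψ₂, hψ₁⟩ := exists_functional_of_distTriang hΔ hΔ' (LinearMap.congr_fun hs)
  exact ⟨C, ψ, P.ext_of_isTriangulatedClosed₃ _ hΔ' hZ₁ hZ₂, fun W hW =>
    serrePairing_bijective_of_functional_of_distTriang hΔ hΔ' (LinearMap.congr_fun hs)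
      hψ₂ hψ₁ hφ₁ hφ₂ hW⟩

instance (P : ObjectProperty T) [P.IsTriangulated] [P.IsClosedUnderIsomorphisms] :
    (HasSerreDual k P).IsTriangulated :=
  have : (HasSerreDual k P).IsTriangulatedClosed₃ :=
    .mk' fun _ hΔ h₁ h₂ => hasSerreDual_of_distTriang P hΔ h₁ h₂
  { exists_zero := by
      refine ⟨0, isZero_zero T, 0, 0, P.prop_zero, fun Y _ => ⟨?_, fun f => ⟨0, ?_⟩⟩⟩
      · intro f g _
        exact (isZero_zero T).eq_of_tgt _ _
      · ext g
        rw [(isZero_zero T).eq_of_src g 0, map_zero, map_zero]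
    toIsTriangulatedClosed₂ := .of_isTriangulatedClosed₃ }

end DualCone

end Triangulated

end SerreDual


/-! ### Bounded complexes in the derived category -/

section BoundedComplexes

variable {C : Type u} [Category.{v} C] [Abelian C]

theorem mono_mkHomFromSingle {K : CochainComplex C ℤ} {X : C} {n : ℤ} (f : X ⟶ K.X n) [Mono f]
    (hf : ∀ j, (ComplexShape.up ℤ).Rel n j → f ≫ K.d n j = 0) :
    Mono (HomologicalComplex.mkHomFromSingle f hf) := by
  refine HomologicalComplex.mono_of_mono_f _ fun i => ?_
  by_cases hi : i = n
  · subst hi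
    rw [HomologicalComplex.mkHomFromSingle_f]
    infer_instance
  · exact ⟨fun _ _ _ => (HomologicalComplex.isZero_single_obj_X _ _ _ _ hi).eq_of_tgt _ _⟩

theorem isZero_cokernel_X {K L : CochainComplex C ℤ} (f : K ⟶ L) (i : ℤ) [Epi (f.f i)] :
    IsZero ((cokernel f).X i) :=
  (isZero_cokernel_of_epi (f.f i)).of_iso
    (PreservesCokernel.iso (HomologicalComplex.eval C (ComplexShape.up ℤ) i) f)

/-- In degrees where a morphism of complexes vanishes, its cokernel is its target. -/
def cokernelXIso {K L : CochainComplex C ℤ} (f : K ⟶ L) (i : ℤ) (hf : f.f i = 0) :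
    (cokernel f).X i ≅ L.X i :=
  PreservesCokernel.iso (HomologicalComplex.eval C (ComplexShape.up ℤ) i) f ≪≫
    cokernelIsoOfEq (g := 0) hf ≪≫ cokernelZeroIsoTarget

variable [HasDerivedCategory.{w} C]

theorem Q_obj_mem_of_bounded (R : ObjectProperty (DerivedCategory C)) [R.IsTriangulated]
    [R.IsClosedUnderIsomorphisms] {a b : ℤ} {K : CochainComplex C ℤ}
    (hK : ∀ i, i < a ∨ b < i → IsZero (K.X i))
    (hR : ∀ i, R ((DerivedCategory.singleFunctor C 0).obj (K.X i))) :
    R (DerivedCategory.Q.obj K) := by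
  obtain ⟨n, hn⟩ : ∃ n : ℕ, b - a < n := ⟨(b - a + 1).toNat, by lia⟩
  induction n generalizing b K with
  | zero =>
    have : IsZero K := by
      rw [IsZero.iff_id_eq_zero]
      ext i
      exact (hK i (by push_cast at hn; lia)).eq_of_src _ _
    exact R.prop_of_isZero (DerivedCategory.Q.map_isZero this)
  | succ n ih =>
    let ι : (HomologicalComplex.single C (ComplexShape.up ℤ) b).obj (K.X b) ⟶ K :=
      HomologicalComplex.mkHomFromSingle (𝟙 _) fun j hj =>
        (hK j (by rw [ComplexShape.up_Rel] at hj; lia)).eq_of_tgt _ _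
    have : Mono ι := mono_mkHomFromSingle _ _
    have hS : (ShortComplex.mk ι (cokernel.π ι) (cokernel.condition ι)).ShortExact :=
      { exact := ShortComplex.exact_cokernel ι }
    have htop : IsZero ((cokernel ι).X b) := by
      have : Epi (ι.f b) := by
        dsimp only [ι]
        rw [HomologicalComplex.mkHomFromSingle_f]
        infer_instance
      exact isZero_cokernel_X ι b
    have hlow (i : ℤ) (hi : i ≠ b) : (cokernel ι).X i ≅ K.X i :=
      cokernelXIso ι i ((HomologicalComplex.isZero_single_obj_X _ _ _ _ hi).eq_of_src _ _)
    refine R.ext_of_isTriangulatedClosed₂ _ (DerivedCategory.triangleOfSES_distinguished hS)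
      (R.prop_of_iso (((DerivedCategory.singleFunctors C).shiftIso (-b) b 0 (by lia)).app (K.X b))
        (R.le_shift (-b) _ (hR b)))
      (ih (b := b - 1) (K := cokernel ι) (fun i hi => ?_) (fun i => ?_)
        (by push_cast at hn; lia))
    · obtain rfl | hib := eq_or_ne i b
      · exact htop
      · exact (hK i (by lia)).of_iso (hlow i hib)
    · obtain rfl | hib := eq_or_ne i b
      · exact R.prop_of_isZero ((DerivedCategory.singleFunctor C 0).map_isZero htop)
      · exact R.prop_of_iso ((DerivedCategory.singleFunctor C 0).mapIso (hlow i hib).symm) (hR i)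

theorem exists_Q_map_eq_of_isKProjective {K L : CochainComplex C ℤ} [K.IsKProjective]
    (f : DerivedCategory.Q.obj K ⟶ DerivedCategory.Q.obj L) :
    ∃ g : K ⟶ L, DerivedCategory.Q.map g = f := by
  obtain ⟨g, hg⟩ := (CochainComplex.IsKProjective.Qh_map_bijective K
    ((HomotopyCategory.quotient _ _).obj L)).2
    ((DerivedCategory.quotientCompQhIso C).hom.app K ≫ f ≫
      (DerivedCategory.quotientCompQhIso C).inv.app L)
  obtain ⟨g, rfl⟩ := (HomotopyCategory.quotient _ _).map_surjective g
  refine ⟨g, ?_⟩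
  rw [← cancel_epi ((DerivedCategory.quotientCompQhIso C).hom.app K),
    ← DerivedCategory.quotientCompQhIso_hom_naturality, hg]
  simp

theorem nonempty_homotopy_zero_of_Q_map_eq_zero {K L : CochainComplex C ℤ} [K.IsKProjective]
    (f : K ⟶ L) (hf : DerivedCategory.Q.map f = 0) : Nonempty (Homotopy f 0) := by
  refine ⟨HomotopyCategory.homotopyOfEq _ _ ?_⟩
  apply (CochainComplex.IsKProjective.Qh_map_bijective K
    ((HomotopyCategory.quotient _ _).obj L)).1
  rw [← cancel_mono ((DerivedCategory.quotientCompQhIso C).hom.app L),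
    DerivedCategory.quotientCompQhIso_hom_naturality, hf]
  simp

end BoundedComplexes

/-! ### The triangulated category of perfect complexes -/

section Perfect

theorem isKProjective_of_projective_of_isZero {R : Type v} [Ring R]
    (K : CochainComplex (ModuleCat.{v} R) ℤ) (b : ℤ) (hb : ∀ i, b < i → IsZero (K.X i))
    (h : ∀ i, Module.Projective R (K.X i)) : K.IsKProjective := by
  have : K.IsStrictlyLE b := (K.isStrictlyLE_iff b).2 hb
  have (i : ℤ) : Projective (K.X i) := (IsProjective.iff_projective (K.X i)).1 (h i)
  exact K.isKProjective_of_projective b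

variable {A : Type v} [Ring A] [HasDerivedCategory.{u'} (ModuleCat.{v} Aᵐᵒᵖ)]

instance : (isPerfect A).IsClosedUnderIsomorphisms where
  of_iso := by
    rintro X Y e ⟨K, hK, hK', ⟨e'⟩⟩
    exact ⟨K, hK, hK', ⟨e.symm ≪≫ e'⟩⟩

instance : (isPerfect A).IsStableUnderShift ℤ where
  isStableUnderShiftBy n :=
    { le_shift := by
        rintro X ⟨K, ⟨a, b, hK⟩, hK', ⟨e⟩⟩
        exact ⟨K⟦n⟧, ⟨a - n, b - n, fun i hi => hK (i + n) (by lia)⟩, fun i => hK' (i + n),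
          ⟨(shiftFunctor _ n).mapIso e ≪≫ (DerivedCategory.Q.commShiftIso n).symm.app K⟩⟩ }

omit [HasDerivedCategory.{u'} (ModuleCat.{v} Aᵐᵒᵖ)] in
theorem finite_projective_mappingCone_X {K L : CochainComplex (ModuleCat.{v} Aᵐᵒᵖ) ℤ} (g : K ⟶ L)
    (hK : ∀ i, Module.Finite Aᵐᵒᵖ (K.X i) ∧ Module.Projective Aᵐᵒᵖ (K.X i))
    (hL : ∀ i, Module.Finite Aᵐᵒᵖ (L.X i) ∧ Module.Projective Aᵐᵒᵖ (L.X i)) (i : ℤ) :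
    Module.Finite Aᵐᵒᵖ ((CochainComplex.mappingCone g).X i) ∧
      Module.Projective Aᵐᵒᵖ ((CochainComplex.mappingCone g).X i) := by
  let e : (CochainComplex.mappingCone g).X i ≅ ModuleCat.of Aᵐᵒᵖ (K.X (i + 1) × L.X i) :=
    HomologicalComplex.homotopyCofiber.XIsoBiprod g i (i + 1) rfl ≪≫ ModuleCat.biprodIsoProd _ _
  obtain ⟨_, _⟩ := hK (i + 1)
  obtain ⟨_, _⟩ := hL i
  exact ⟨Module.Finite.equiv e.symm.toLinearEquiv,
    Module.Projective.of_equiv e.symm.toLinearEquiv⟩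

theorem isPerfect_of_distTriang {Δ : Triangle (DerivedCategory (ModuleCat.{v} Aᵐᵒᵖ))}
    (hΔ : Δ ∈ distTriang _) (h₁ : isPerfect A Δ.obj₁) (h₂ : isPerfect A Δ.obj₂) :
    isPerfect A Δ.obj₃ := by
  obtain ⟨K, ⟨a, b, hK⟩, hK', ⟨e⟩⟩ := h₁
  obtain ⟨L, ⟨a', b', hL⟩, hL', ⟨e'⟩⟩ := h₂
  have := isKProjective_of_projective_of_isZero K b (fun i hi => hK i (Or.inr hi))
    (fun i => (hK' i).2)
  obtain ⟨g, hg⟩ := exists_Q_map_eq_of_isKProjective (e.inv ≫ Δ.mor₁ ≫ e'.hom)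
  have hcomm : Δ.mor₁ ≫ e'.hom = e.hom ≫ DerivedCategory.Q.map g := by
    rw [hg, e.hom_inv_id_assoc]
  have hcone :=
    isoTriangleOfIso₁₂ _ _ hΔ (DerivedCategory.mappingCone_triangle_distinguished g) e e' hcomm
  refine ⟨CochainComplex.mappingCone g, ⟨min (a - 1) a', max b b', fun i hi => ?_⟩,
    finite_projective_mappingCone_X g hK' hL', ⟨Triangle.π₃.mapIso hcone⟩⟩
  refine IsZero.of_iso ?_ (HomologicalComplex.homotopyCofiber.XIsoBiprod g i (i + 1) rfl)
  rw [biprod_isZero_iff]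
  exact ⟨hK _ (by lia), hL _ (by lia)⟩

theorem isPerfect_single (P : ModuleCat.{v} Aᵐᵒᵖ) [Module.Finite Aᵐᵒᵖ P]
    [Module.Projective Aᵐᵒᵖ P] : isPerfect A ((DerivedCategory.singleFunctor _ 0).obj P) := by
  refine ⟨(HomologicalComplex.single _ (ComplexShape.up ℤ) 0).obj P,
    ⟨0, 0, fun i hi => HomologicalComplex.isZero_single_obj_X _ _ _ _ (by lia)⟩, fun i => ?_,
    ⟨Iso.refl _⟩⟩
  obtain rfl | hi := eq_or_ne i 0
  · let e := (HomologicalComplex.singleObjXSelf (ComplexShape.up ℤ) 0 P).symm.toLinearEquiv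
    exact ⟨Module.Finite.equiv e, Module.Projective.of_equiv e⟩
  · have := ModuleCat.subsingleton_of_isZero
      (HomologicalComplex.isZero_single_obj_X (ComplexShape.up ℤ) 0 P i hi)
    exact ⟨inferInstance, inferInstance⟩

instance : (isPerfect A).IsTriangulated :=
  have : (isPerfect A).IsTriangulatedClosed₃ :=
    .mk' fun _ hΔ h₁ h₂ => isPerfect_of_distTriang hΔ h₁ h₂
  { exists_zero := ⟨_, (DerivedCategory.singleFunctor _ 0).map_isZero
      (ModuleCat.isZero_of_subsingleton (ModuleCat.of Aᵐᵒᵖ PUnit)), isPerfect_single _⟩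
    toIsTriangulatedClosed₂ := .of_isTriangulatedClosed₃ }

theorem isPerfect_le_of_single (R : ObjectProperty (DerivedCategory (ModuleCat.{v} Aᵐᵒᵖ)))
    [R.IsTriangulated] [R.IsClosedUnderIsomorphisms]
    (hR : ∀ P : ModuleCat.{v} Aᵐᵒᵖ, Module.Finite Aᵐᵒᵖ P → Module.Projective Aᵐᵒᵖ P →
      R ((DerivedCategory.singleFunctor _ 0).obj P)) : isPerfect A ≤ R := by
  rintro X ⟨K, ⟨a, b, hK⟩, hK', ⟨e⟩⟩
  exact R.prop_of_iso e.symm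
    (Q_obj_mem_of_bounded R hK fun i => hR _ (hK' i).1 (hK' i).2)

end Perfect


/-! ### Modules over directed algebras -/

section RegularModule

variable {A : Type v} [Ring A]

variable (A) in
/-- The regular right module `A`, identified with the regular left module of the opposite ring. -/
def opRegularEquiv : Aᵐᵒᵖ ≃ₗ[Aᵐᵒᵖ] A :=
  { (opAddEquiv (α := A)).symm with
    map_smul' := fun _ _ => rfl }

instance : Module.Finite Aᵐᵒᵖ A := Module.Finite.equiv (opRegularEquiv A)

instance : Module.Projective Aᵐᵒᵖ A := Module.Projective.of_equiv (opRegularEquiv A)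

variable (A) in
/-- The regular right module as an object of the category of modules. It is not reducible: the left
multiplications on `A` would otherwise give a second `k`-linear structure on its morphisms. -/
def regularModule : ModuleCat.{v} Aᵐᵒᵖ := ModuleCat.of Aᵐᵒᵖ A

instance : Module.Finite Aᵐᵒᵖ (regularModule A) := inferInstanceAs (Module.Finite Aᵐᵒᵖ A)

instance : Module.Projective Aᵐᵒᵖ (regularModule A) :=
  inferInstanceAs (Module.Projective Aᵐᵒᵖ A)

/-- The homomorphism of right modules `A → M` that sends `1` to `m`. -/
def toSpanSingletonOp {M : Type*} [AddCommGroup M] [Module Aᵐᵒᵖ M] (m : M) : A →ₗ[Aᵐᵒᵖ] M :=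
  LinearMap.toSpanSingleton Aᵐᵒᵖ M m ∘ₗ (opRegularEquiv A).symm.toLinearMap

/-- The right ideal `e A` generated by an idempotent `e`, encoded as the set of fixed points of
left multiplication by `e`. -/
def idempotentIdeal (e : A) : Submodule Aᵐᵒᵖ A where
  carrier := {a | e * a = a}
  add_mem' := by
    intro a b ha hb
    rw [Set.mem_ofPred_eq, mul_add, ha, hb]
  zero_mem' := mul_zero e
  smul_mem' := by
    intro c a ha
    rw [Set.mem_ofPred_eq, ← op_unop c, op_smul_eq_mul, ← mul_assoc, ha]

theorem mem_idempotentIdeal {e a : A} : a ∈ idempotentIdeal e ↔ e * a = a := Iff.rfl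

/-- The projection `a ↦ e a` of the regular right module to `e A`. -/
def toIdempotentIdeal {e : A} (he : IsIdempotentElem e) : A →ₗ[Aᵐᵒᵖ] idempotentIdeal e where
  toFun a := ⟨e * a, by rw [mem_idempotentIdeal, ← mul_assoc, he.eq]⟩
  map_add' a b := Subtype.ext (mul_add e a b)
  map_smul' c a := Subtype.ext (mul_assoc e a c.unop).symm

theorem toIdempotentIdeal_comp_subtype {e : A} (he : IsIdempotentElem e) :
    toIdempotentIdeal he ∘ₗ (idempotentIdeal e).subtype = LinearMap.id :=
  LinearMap.ext fun a => Subtype.ext a.2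

theorem finite_idempotentIdeal {e : A} (he : IsIdempotentElem e) :
    Module.Finite Aᵐᵒᵖ (idempotentIdeal e) :=
  Module.Finite.of_surjective (toIdempotentIdeal he)
    (LinearMap.surjective_of_comp_eq_id _ _ (toIdempotentIdeal_comp_subtype he))

theorem projective_idempotentIdeal {e : A} (he : IsIdempotentElem e) :
    Module.Projective Aᵐᵒᵖ (idempotentIdeal e) :=
  Module.Projective.of_split _ _ (toIdempotentIdeal_comp_subtype he)

/-- The right module `e A` as an object of the category of modules. -/
def idempotentModule (e : A) : ModuleCat.{v} Aᵐᵒᵖ := ModuleCat.of Aᵐᵒᵖ (idempotentIdeal e)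

end RegularModule

section Single

variable {A : Type v} [Ring A] [HasDerivedCategory.{u'} (ModuleCat.{v} Aᵐᵒᵖ)]

theorem isPerfect_idempotentModule {e : A} (he : IsIdempotentElem e) :
    isPerfect A ((DerivedCategory.singleFunctor _ 0).obj (idempotentModule e)) :=
  have : Module.Finite Aᵐᵒᵖ (idempotentModule e) := finite_idempotentIdeal he
  have : Module.Projective Aᵐᵒᵖ (idempotentModule e) := projective_idempotentIdeal he
  isPerfect_single _

variable (R : ObjectProperty (DerivedCategory (ModuleCat.{v} Aᵐᵒᵖ)))
  [R.IsTriangulated] [R.IsClosedUnderIsomorphisms]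

theorem single_mem_of_exact {M₁ M₂ M₃ : ModuleCat.{v} Aᵐᵒᵖ} {f : M₁ →ₗ[Aᵐᵒᵖ] M₂}
    {g : M₂ →ₗ[Aᵐᵒᵖ] M₃} (hfg : Function.Exact f g) (hf : Function.Injective f)
    (hg : Function.Surjective g) (h₁ : R ((DerivedCategory.singleFunctor _ 0).obj M₁))
    (h₃ : R ((DerivedCategory.singleFunctor _ 0).obj M₃)) :
    R ((DerivedCategory.singleFunctor _ 0).obj M₂) :=
  have hS : (ShortComplex.mk (ModuleCat.ofHom f) (ModuleCat.ofHom g)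
      (ModuleCat.hom_ext hfg.linearMap_comp_eq_zero)).ShortExact :=
    ModuleCat.shortComplex_shortExact _ hfg hf hg
  R.ext_of_isTriangulatedClosed₂ _ hS.singleTriangle_distinguished h₁ h₃

theorem single_mem_of_subsingleton (M : ModuleCat.{v} Aᵐᵒᵖ) [Subsingleton M] :
    R ((DerivedCategory.singleFunctor _ 0).obj M) :=
  R.prop_of_isZero ((DerivedCategory.singleFunctor _ 0).map_isZero
    (ModuleCat.isZero_of_subsingleton M))

theorem single_mem_pi {M : ModuleCat.{v} Aᵐᵒᵖ}
    (hM : R ((DerivedCategory.singleFunctor _ 0).obj M)) (n : ℕ) :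
    R ((DerivedCategory.singleFunctor _ 0).obj (ModuleCat.of Aᵐᵒᵖ (Fin n → M))) := by
  induction n with
  | zero => exact single_mem_of_subsingleton R _
  | succ n ih =>
    refine R.prop_of_iso ((DerivedCategory.singleFunctor _ 0).mapIso
      (Fin.consLinearEquiv Aᵐᵒᵖ fun _ : Fin (n + 1) => M).toModuleIso) ?_
    exact single_mem_of_exact R (M₂ := ModuleCat.of Aᵐᵒᵖ (M × (Fin n → M)))
      (f := LinearMap.inl Aᵐᵒᵖ M (Fin n → M)) (g := LinearMap.snd Aᵐᵒᵖ M (Fin n → M))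
      Function.Exact.inl_snd LinearMap.inl_injective LinearMap.snd_surjective hM ih

theorem isPerfect_le_of_regularModule [R.IsStableUnderRetracts]
    (hR : R ((DerivedCategory.singleFunctor _ 0).obj (regularModule A))) : isPerfect A ≤ R := by
  refine isPerfect_le_of_single R fun P _ _ => ?_
  obtain ⟨n, f, g, -, -, hfg⟩ := Module.Finite.exists_comp_eq_id_of_projective Aᵐᵒᵖ P
  have hA : R ((DerivedCategory.singleFunctor _ 0).obj (ModuleCat.of Aᵐᵒᵖ Aᵐᵒᵖ)) :=
    R.prop_of_iso ((DerivedCategory.singleFunctor _ 0).mapIso (opRegularEquiv A).symm.toModuleIso)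
      hR
  let r : Retract P (ModuleCat.of Aᵐᵒᵖ (Fin n → Aᵐᵒᵖ)) :=
    ⟨ModuleCat.ofHom g, ModuleCat.ofHom f, congrArg ModuleCat.ofHom hfg⟩
  exact R.prop_of_retract (r.map (DerivedCategory.singleFunctor _ 0)) (single_mem_pi R hA n)

variable (A) in
/-- The free module of rank one, placed in degree `n`, as a perfect complex. -/
def regularPerf (n : ℤ) : Perf A :=
  ⟨(DerivedCategory.singleFunctor _ n).obj (regularModule A),
    (isPerfect A).prop_of_iso
      (((DerivedCategory.singleFunctors (ModuleCat.{v} Aᵐᵒᵖ)).shiftIso (-n) n 0 (by lia)).app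
        (regularModule A))
      ((isPerfect A).le_shift (-n) _ (isPerfect_single (regularModule A)))⟩

theorem isClassicalGenerator_regularPerf : IsClassicalGenerator (regularPerf A 0) := fun X =>
  isPerfect_le_of_regularModule _
    (ObjectProperty.le_triangEnvelope _ _ (ObjectProperty.singleton_iff _ _ |>.2 rfl)) _ X.property

end Single

/-- A complete family of orthogonal idempotents `e i` of a `k`-algebra is directed if
`e i A e j = 0` for `i < j` and `e i A e i = k e i`. -/
structure IsDirectedFamily (k : Type u) [Field k] {A : Type v} [Ring A] [Algebra k A] {V : Type w}
    [Fintype V] [LinearOrder V] (e : V → A) : Prop extends CompleteOrthogonalIdempotents e where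
  eq_zero_of_lt : ∀ (i j : V) (x : A), i < j → e i * x * e j = 0
  exists_smul : ∀ (i : V) (x : A), ∃ c : k, e i * x * e i = c • e i

namespace IsDirectedFamily

variable {k : Type u} [Field k] {A : Type v} [Ring A] [Algebra k A] {V : Type w}
  [Fintype V] [LinearOrder V] {e : V → A} (he : IsDirectedFamily k e)

include he

theorem sum_op_smul {M : Type*} [AddCommGroup M] [Module Aᵐᵒᵖ M] (m : M) :
    ∑ i, op (e i) • m = m := by
  rw [← Finset.sum_smul, ← Finset.op_sum, he.complete, op_one, one_smul]

theorem op_smul_smul_smul_eq_zero {M : Type*} [AddCommGroup M] [Module Aᵐᵒᵖ M]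
    {i j : V} (hij : i < j) (a : Aᵐᵒᵖ) (m : M) : op (e j) • a • op (e i) • m = 0 := by
  rw [smul_smul, smul_smul, ← op_unop a, ← op_mul, ← op_mul, ← mul_assoc,
    he.eq_zero_of_lt i j _ hij, MulOpposite.op_zero, zero_smul]

theorem exists_op_smul_eq_self_of_isSimpleModule (M : Type*) [AddCommGroup M] [Module Aᵐᵒᵖ M]
    [IsSimpleModule Aᵐᵒᵖ M] : ∃ j, ∀ m : M, op (e j) • m = m := by
  have := IsSimpleModule.nontrivial Aᵐᵒᵖ M
  have hne : ∃ j, ∃ m : M, op (e j) • m ≠ 0 := by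
    by_contra! h
    obtain ⟨x, hx⟩ := exists_ne (0 : M)
    exact hx (by rw [← he.sum_op_smul x, Finset.sum_eq_zero fun i _ => h i x])
  obtain ⟨j, ⟨m, hm⟩, hmin⟩ := exists_minimal_of_wellFoundedLT _ hne
  refine ⟨j, fun x => ?_⟩
  obtain ⟨a, rfl⟩ := IsSimpleModule.toSpanSingleton_surjective Aᵐᵒᵖ hm x
  have hvanish (i : V) (hij : i ≠ j) : op (e i) • a • op (e j) • m = 0 := by
    rcases hij.lt_or_gt with h | h
    · by_contra hx
      exact h.not_ge (hmin ⟨_, hx⟩ h.le)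
    · exact he.op_smul_smul_smul_eq_zero h a m
  have hsum := he.sum_op_smul (a • op (e j) • m)
  rwa [Finset.sum_eq_single j (fun i _ hi => hvanish i hi) (by simp)] at hsum

theorem mul_eq_zero_of_op_smul_eq_zero {M : Type*} [AddCommGroup M] [Module Aᵐᵒᵖ M] {i j : V}
    (hij : ¬ i < j) {x : M} (hx : x ≠ 0) (hxj : op (e j) • x = x) {a : A} (ha : e j * a = a)
    (hax : op a • x = 0) : a * e i = 0 := by
  rcases (not_lt.1 hij).lt_or_eq with h | rfl
  · rw [← ha]
    exact he.eq_zero_of_lt j i a h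
  obtain ⟨c, hc⟩ := he.exists_smul j a
  rw [ha] at hc
  rcases eq_or_ne c 0 with rfl | hc0
  · rw [hc, zero_smul]
  refine absurd ?_ hx
  have hej : e j = a * e j * algebraMap k A c⁻¹ := by
    rw [hc, ← Algebra.commutes, ← Algebra.smul_def, inv_smul_smul₀ hc0]
  rw [← hxj, hej, op_mul, op_mul, mul_smul, mul_smul, hax, smul_zero, smul_zero]

variable [IsArtinianRing Aᵐᵒᵖ] [HasDerivedCategory.{u'} (ModuleCat.{v} Aᵐᵒᵖ)]
  (R : ObjectProperty (DerivedCategory (ModuleCat.{v} Aᵐᵒᵖ)))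
  [R.IsTriangulated] [R.IsClosedUnderIsomorphisms]

theorem single_mem_of_support (U : V → Prop)
    (hU : ∀ i, U i → ∀ M : ModuleCat.{v} Aᵐᵒᵖ, IsSimpleModule Aᵐᵒᵖ M →
      (∀ m : M, op (e i) • m = m) → R ((DerivedCategory.singleFunctor _ 0).obj M))
    (M : Type v) [AddCommGroup M] [Module Aᵐᵒᵖ M] [Module.Finite Aᵐᵒᵖ M]
    (hM : ∀ i, ¬ U i → ∀ m : M, op (e i) • m = 0) :
    R ((DerivedCategory.singleFunctor _ 0).obj (ModuleCat.of Aᵐᵒᵖ M)) := by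
  have hlen : IsFiniteLength Aᵐᵒᵖ M :=
    isFiniteLength_iff_isNoetherian_isArtinian.2 ⟨inferInstance, inferInstance⟩
  induction hlen with
  | of_subsingleton => exact single_mem_of_subsingleton R _
  | @of_simple_quotient M _ _ N _ _ ih =>
    refine single_mem_of_exact R (M₁ := ModuleCat.of Aᵐᵒᵖ N) (M₂ := ModuleCat.of Aᵐᵒᵖ M)
      (M₃ := ModuleCat.of Aᵐᵒᵖ (M ⧸ N)) (LinearMap.exact_subtype_mkQ N) N.injective_subtype
      N.mkQ_surjective (ih fun i hi m => Subtype.ext (hM i hi m)) ?_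
    obtain ⟨j, hj⟩ := he.exists_op_smul_eq_self_of_isSimpleModule (M ⧸ N)
    refine hU j ?_ _ inferInstance hj
    by_contra hUj
    have := IsSimpleModule.nontrivial Aᵐᵒᵖ (M ⧸ N)
    obtain ⟨x, hx⟩ := exists_ne (0 : M ⧸ N)
    obtain ⟨m, rfl⟩ := N.mkQ_surjective x
    exact hx (by rw [← hj (N.mkQ m), ← map_smul, hM j hUj, map_zero])

variable (hR : ∀ i, R ((DerivedCategory.singleFunctor _ 0).obj (idempotentModule (e i))))

include hR

-- The simple module at `j` is a quotient of `e j A`, whose kernel is supported below `j`.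
theorem single_mem_of_isSimpleModule (j : V) (M : ModuleCat.{v} Aᵐᵒᵖ)
    (hM : IsSimpleModule Aᵐᵒᵖ M) (hMj : ∀ m : M, op (e j) • m = m) :
    R ((DerivedCategory.singleFunctor _ 0).obj M) := by
  induction j using WellFoundedLT.induction generalizing M with
  | ind j ih =>
  have := IsSimpleModule.nontrivial Aᵐᵒᵖ M
  obtain ⟨x, hx⟩ := exists_ne (0 : M)
  let f : idempotentIdeal (e j) →ₗ[Aᵐᵒᵖ] M := (toSpanSingletonOp x).domRestrict _
  have hsurj : Function.Surjective f := by
    intro m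
    obtain ⟨a, rfl⟩ := IsSimpleModule.toSpanSingleton_surjective Aᵐᵒᵖ hx m
    refine ⟨toIdempotentIdeal (he.idem j) a.unop, ?_⟩
    change op (e j * a.unop) • x = a • x
    rw [op_mul, mul_smul, hMj, op_unop]
  have hker : R ((DerivedCategory.singleFunctor _ 0).obj
      (ModuleCat.of Aᵐᵒᵖ (LinearMap.ker f))) := by
    have := finite_idempotentIdeal (he.idem j)
    refine he.single_mem_of_support R (· < j) (fun i hi M hM hMi => ih i hi M hM hMi) _ ?_
    rintro i hi ⟨⟨a, ha⟩, hax⟩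
    exact Subtype.ext (Subtype.ext (he.mul_eq_zero_of_op_smul_eq_zero hi hx (hMj x) ha hax))
  exact R.ext_of_isTriangulatedClosed₃ _
    (LinearMap.shortExact_shortComplexKer hsurj).singleTriangle_distinguished hker (hR j)

theorem single_mem_of_finite (M : ModuleCat.{v} Aᵐᵒᵖ) [Module.Finite Aᵐᵒᵖ M] :
    R ((DerivedCategory.singleFunctor _ 0).obj M) :=
  he.single_mem_of_support R (fun _ => True) (fun i _ => he.single_mem_of_isSimpleModule R hR i) M
    (by simp)

theorem isPerfect_le : isPerfect A ≤ R :=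
  isPerfect_le_of_single R fun P _ _ => he.single_mem_of_finite R hR P

omit R hR [R.IsTriangulated] [R.IsClosedUnderIsomorphisms] in
theorem isPerfect_single_of_finite (M : ModuleCat.{v} Aᵐᵒᵖ) [Module.Finite Aᵐᵒᵖ M] :
    isPerfect A ((DerivedCategory.singleFunctor _ 0).obj M) :=
  he.single_mem_of_finite _ (fun i => isPerfect_idempotentModule (he.idem i)) M

end IsDirectedFamily


/-! ### Finiteness of spaces of morphisms -/

section HomFinite

variable {k : Type u} [Field k]

theorem finiteDimensional_of_exact {M₁ M₂ M₃ : Type*} [AddCommGroup M₁] [Module k M₁]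
    [AddCommGroup M₂] [Module k M₂] [AddCommGroup M₃] [Module k M₃] {f : M₁ →ₗ[k] M₂}
    {g : M₂ →ₗ[k] M₃} (h : Function.Exact f g) [FiniteDimensional k M₁]
    [FiniteDimensional k M₃] : FiniteDimensional k M₂ :=
  IsNoetherian.iff_fg.1 (isNoetherian_of_range_eq_ker f g h.linearMap_ker_eq.symm)

variable {T : Type v} [Category.{w} T] [Preadditive T] [Linear k T] [HasShift T ℤ]

variable (k) in
/-- The objects `Y` such that all `Hom(X, Y[n])` are finite-dimensional. -/
def homFiniteFrom (X : T) : ObjectProperty T := fun Y =>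
  ∀ n : ℤ, FiniteDimensional k (X ⟶ Y⟦n⟧)

variable (k) in
/-- The objects `X` such that all `Hom(X[n], Y)` are finite-dimensional. -/
def homFiniteTo (Y : T) : ObjectProperty T := fun X =>
  ∀ n : ℤ, FiniteDimensional k (X⟦n⟧ ⟶ Y)

instance (X : T) : (homFiniteFrom k X).IsStableUnderRetracts where
  of_retract r h n :=
    have := h n
    have hr : r.i⟦n⟧' ≫ r.r⟦n⟧' = 𝟙 _ := (r.map (shiftFunctor T n)).retract
    FiniteDimensional.of_injective (Linear.rightComp k X (r.i⟦n⟧')) fun f g hfg => by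
      simpa [hr] using congrArg (· ≫ r.r⟦n⟧') hfg

instance (Y : T) : (homFiniteTo k Y).IsStableUnderRetracts where
  of_retract r h n :=
    have := h n
    have hr : r.i⟦n⟧' ≫ r.r⟦n⟧' = 𝟙 _ := (r.map (shiftFunctor T n)).retract
    FiniteDimensional.of_injective (Linear.leftComp k Y (r.r⟦n⟧')) fun f g hfg => by
      simpa [reassoc_of% hr] using congrArg (r.i⟦n⟧' ≫ ·) hfg

variable [HasZeroObject T] [∀ n : ℤ, (shiftFunctor T n).Additive] [Pretriangulated T]

instance (X : T) : (homFiniteFrom k X).IsTriangulated where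
  exists_zero := ⟨0, isZero_zero T, fun n => by
    have : Subsingleton (X ⟶ (0 : T)⟦n⟧) :=
      ⟨fun _ _ => ((shiftFunctor T n).map_isZero (isZero_zero T)).eq_of_tgt _ _⟩
    infer_instance⟩
  isStableUnderShiftBy n :=
    { le_shift := fun Y hY m =>
        have := hY (n + m)
        (Linear.homCongr k (Iso.refl X) ((shiftFunctorAdd T n m).app Y)).finiteDimensional }
  toIsTriangulatedClosed₂ := .mk' fun Δ hΔ h₁ h₃ n =>
    have : FiniteDimensional k (X ⟶ (Δ⟦n⟧).obj₁) := h₁ n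
    have : FiniteDimensional k (X ⟶ (Δ⟦n⟧).obj₃) := h₃ n
    finiteDimensional_of_exact
      (exact_rightComp_mor₂ (k := k) (Triangle.shift_distinguished Δ hΔ n) X)

instance (Y : T) : (homFiniteTo k Y).IsTriangulated where
  exists_zero := ⟨0, isZero_zero T, fun n => by
    have : Subsingleton ((0 : T)⟦n⟧ ⟶ Y) :=
      ⟨fun _ _ => ((shiftFunctor T n).map_isZero (isZero_zero T)).eq_of_src _ _⟩
    infer_instance⟩
  isStableUnderShiftBy n :=
    { le_shift := fun X hX m =>
        have := hX (n + m)
        (Linear.homCongr k ((shiftFunctorAdd T n m).app X) (Iso.refl Y)).finiteDimensional }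
  toIsTriangulatedClosed₂ := .mk' fun Δ hΔ h₁ h₃ n =>
    have : FiniteDimensional k ((Δ⟦n⟧).obj₁ ⟶ Y) := h₁ n
    have : FiniteDimensional k ((Δ⟦n⟧).obj₃ ⟶ Y) := h₃ n
    finiteDimensional_of_exact
      (exact_leftComp_mor₁ (k := k) (Triangle.shift_distinguished Δ hΔ n) Y)

end HomFinite

theorem subsingleton_hom_single_shift_of_projective {C : Type u} [Category.{v} C] [Abelian C]
    [HasDerivedCategory.{w} C] (P M : C) [Projective P] {n : ℤ} (hn : n ≠ 0) :
    Subsingleton ((DerivedCategory.singleFunctor C 0).obj P ⟶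
      ((DerivedCategory.singleFunctor C 0).obj M)⟦n⟧) := by
  refine subsingleton_of_forall_eq 0 fun f => ?_
  let e := ((DerivedCategory.singleFunctors C).shiftIso n (-n) 0 (by lia)).app M
  suffices f ≫ e.hom = 0 by rw [← cancel_mono e.hom, this, zero_comp]
  rcases hn.lt_or_gt with h | h
  · exact DerivedCategory.TStructure.t.zero_of_isLE_of_isGE (f ≫ e.hom) 0 (-n) (by lia)
      (inferInstanceAs (((DerivedCategory.singleFunctor C 0).obj P).IsLE 0))
      (inferInstanceAs (((DerivedCategory.singleFunctor C (-n)).obj M).IsGE (-n)))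
  · exact DerivedCategory.from_singleFunctor_obj_eq_zero_of_projective
      (L := (CochainComplex.singleFunctor C (-n)).obj M) (i := 0) (f ≫ e.hom) (-n) (by lia)

section RegularModule

variable (k : Type u) [Field k] {A : Type v} [Ring A] [Algebra k A]

instance : Projective (regularModule A) :=
  (IsProjective.iff_projective _).1 inferInstance

variable (A) in
/-- The endomorphisms of the regular right module are the left multiplications. -/
def regularModuleEnd : A ≃ₗ[k] (regularModule A ⟶ regularModule A) :=
  { (RingEquiv.moduleEndSelfOp A).toAddEquiv.trans
      (ModuleCat.homAddEquiv (M := regularModule A) (N := regularModule A)).symm with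
    map_smul' := fun c a => ModuleCat.hom_ext <| LinearMap.ext fun x : A =>
      show (c • a) * x = (a * x) * algebraMap k A c by
        rw [← Algebra.commutes, ← Algebra.smul_def, smul_mul_assoc] }

theorem regularModuleEnd_mul (a b : A) :
    regularModuleEnd k A (b * a) = regularModuleEnd k A a ≫ regularModuleEnd k A b :=
  ModuleCat.hom_ext (LinearMap.ext fun x : A => mul_assoc b a x)

theorem finiteDimensional_hom_of_isPerfect [FiniteDimensional k A]
    [HasDerivedCategory.{u'} (ModuleCat.{v} Aᵐᵒᵖ)] {X Y : DerivedCategory (ModuleCat.{v} Aᵐᵒᵖ)}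
    (hX : isPerfect A X) (hY : isPerfect A Y) : FiniteDimensional k (X ⟶ Y) := by
  let single := DerivedCategory.singleFunctor (ModuleCat.{v} Aᵐᵒᵖ) 0
  have hEnd (n : ℤ) :
      FiniteDimensional k (single.obj (regularModule A) ⟶ (single.obj (regularModule A))⟦n⟧) := by
    rcases eq_or_ne n 0 with rfl | hn
    · have := (regularModuleEnd k A).finiteDimensional
      exact ((homLinearEquivOfFullyFaithful k single (regularModule A) (regularModule A)).trans
        (Linear.homCongr k (Iso.refl _) ((shiftFunctorZero _ ℤ).symm.app _))).finiteDimensional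
    · have := subsingleton_hom_single_shift_of_projective (regularModule A) (regularModule A) hn
      infer_instance
  have hFrom : isPerfect A ≤ homFiniteFrom k (single.obj (regularModule A)) :=
    isPerfect_le_of_regularModule _ hEnd
  have hTo : isPerfect A ≤ homFiniteTo k Y := isPerfect_le_of_regularModule _ fun n =>
    have := hFrom Y hY (-n)
    ((homLinearEquivOfFullyFaithful k (shiftFunctor _ n) _ (Y⟦-n⟧)).trans
      (Linear.homCongr k (Iso.refl _) ((shiftEquiv _ n).counitIso.app Y))).finiteDimensional
  have := hTo X hX 0
  exact (Linear.homCongr k ((shiftFunctorZero _ ℤ).app X) (Iso.refl Y)).finiteDimensional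

end RegularModule


/-! ### Existence of Serre functors -/

section SerreIdeal

variable (k : Type u) [Field k] (A : Type v) [Ring A] [Algebra k A]

instance : IsScalarTower k Aᵐᵒᵖ (SerreBimodule k A) where
  smul_assoc c a f := DFunLike.ext _ _ fun x =>
    (congrArg f (smul_mul_assoc c a.unop x)).trans (LinearMap.map_smul (f : A →ₗ[k] k) c _)

instance [FiniteDimensional k A] : FiniteDimensional k (SerreBimodule k A) :=
  inferInstanceAs (FiniteDimensional k (A →ₗ[k] k))

theorem isArtinianRing_op [FiniteDimensional k A] : IsArtinianRing Aᵐᵒᵖ :=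
  have : FiniteDimensional k Aᵐᵒᵖ := (opLinearEquiv k (M := A)).finiteDimensional
  IsArtinianRing.of_finite k Aᵐᵒᵖ

variable {A}

/-- The right module `e A^*` for an idempotent `e`, encoded as the set of functionals on `A` that
are invariant under right multiplication by `e`. -/
def serreIdeal (e : A) : Submodule Aᵐᵒᵖ (SerreBimodule k A) where
  carrier := {f | ∀ x, f (x * e) = f x}
  add_mem' hf hg x := congrArg₂ (· + ·) (hf x) (hg x)
  zero_mem' _ := rfl
  smul_mem' c f hf x := (congrArg f (mul_assoc c.unop x e)).symm.trans (hf (c.unop * x))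

instance [FiniteDimensional k A] (e : A) : Module.Finite Aᵐᵒᵖ (serreIdeal k e) :=
  have := isArtinianRing_op k A
  have : Module.Finite Aᵐᵒᵖ (SerreBimodule k A) := .of_restrictScalars_finite k _ _
  inferInstance

end SerreIdeal

section IdempotentModule

variable {A : Type v} [Ring A] {e : A} {Y : ModuleCat.{v} Aᵐᵒᵖ}

variable (e) in
/-- The homomorphism of right modules `e A → Y` that sends `e` to `m e`. -/
def idempotentModuleHom (m : Y) : idempotentModule e ⟶ Y :=
  ModuleCat.ofHom (toSpanSingletonOp m ∘ₗ (idempotentIdeal e).subtype)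

/-- The image of the generator `e` under a homomorphism of right modules `e A → Y`. -/
def imageOfIdempotent (he : IsIdempotentElem e) (f : idempotentModule e ⟶ Y) : Y :=
  f.hom (⟨e, he⟩ : idempotentIdeal e)

theorem idempotentModuleHom_imageOfIdempotent (he : IsIdempotentElem e)
    (f : idempotentModule e ⟶ Y) : idempotentModuleHom e (imageOfIdempotent he f) = f :=
  ModuleCat.hom_ext <| LinearMap.ext fun a : idempotentIdeal e =>
    (f.hom.map_smul (op (a : A)) (⟨e, he⟩ : idempotentIdeal e)).symm.trans
      (congrArg f.hom (Subtype.ext a.2))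

theorem idempotentModuleHom_op_smul_self (m : Y) :
    idempotentModuleHom e (op e • m) = idempotentModuleHom e m :=
  ModuleCat.hom_ext <| LinearMap.ext fun a : idempotentIdeal e =>
    show op (a : A) • op e • m = op (a : A) • m by rw [smul_smul, ← op_mul, a.2]

theorem idempotentModuleHom_add (m m' : Y) :
    idempotentModuleHom e (m + m') = idempotentModuleHom e m + idempotentModuleHom e m' :=
  ModuleCat.hom_ext <| LinearMap.ext fun a : idempotentIdeal e => smul_add (op (a : A)) m m'

theorem idempotentModuleHom_smul_op_smul {k : Type u} [Field k] [Algebra k A] (c : k) (x : A)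
    (m : Y) : idempotentModuleHom e (op (c • x) • m) = c • idempotentModuleHom e (op x • m) :=
  ModuleCat.hom_ext <| LinearMap.ext fun a : idempotentIdeal e =>
    show op (a : A) • op (c • x) • m = op (algebraMap k A c) • op (a : A) • op x • m by
      simp only [smul_smul, ← op_mul, smul_mul_assoc, ← Algebra.smul_def, ← Algebra.commutes c]

theorem idempotentModuleHom_comp {Z : ModuleCat.{v} Aᵐᵒᵖ} (m : Y) (g : Y ⟶ Z) :
    idempotentModuleHom e m ≫ g = idempotentModuleHom e (g.hom m) :=
  ModuleCat.hom_ext <| LinearMap.ext fun a : idempotentIdeal e => g.hom.map_smul (op (a : A)) m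

end IdempotentModule

section SerreModule

variable {k : Type u} [Field k] {A : Type (max u v)} [Ring A] [Algebra k A] {e : A}

variable (k) in
/-- The right module `e A^*` as an object of the category of modules. -/
def serreModule (e : A) : ModuleCat.{max u v} Aᵐᵒᵖ := ModuleCat.of Aᵐᵒᵖ (serreIdeal k e)

/-- The elements of `e A^*` are functionals on `A`. -/
def serreModule.toDual (f : serreModule.{u, v} k e) : SerreBimodule k A :=
  (show serreIdeal k e from f).1

/-- The canonical functional on `Hom(e A, e A^*)`, evaluation of the image of `e` at `1`. -/
def serreFunctional (he : IsIdempotentElem e) :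
    (idempotentModule e ⟶ serreModule.{u, v} k e) →ₗ[k] k where
  toFun f := serreModule.toDual (imageOfIdempotent he f) 1
  map_add' f g := rfl
  map_smul' c f := by
    change serreModule.toDual (imageOfIdempotent he f) (algebraMap k A c * 1) = _
    rw [← Algebra.smul_def]
    exact LinearMap.map_smul (serreModule.toDual (imageOfIdempotent he f) : A →ₗ[k] k) c _

theorem serreFunctional_idempotentModuleHom (he : IsIdempotentElem e)
    (f : serreModule.{u, v} k e) :
    serreFunctional he (idempotentModuleHom e f) = serreModule.toDual f 1 :=
  (congrArg (serreModule.toDual f) (mul_one e)).trans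
    ((congrArg (serreModule.toDual f) (one_mul e)).symm.trans
      ((show serreIdeal k e from f).2 1))

theorem serrePairing_serreFunctional_apply (he : IsIdempotentElem e)
    {Y : ModuleCat.{max u v} Aᵐᵒᵖ} (g : Y ⟶ serreModule.{u, v} k e) (y : Y) :
    serrePairing (serreFunctional he) Y g (idempotentModuleHom e y) =
      serreModule.toDual (g.hom y) 1 := by
  rw [serrePairing_apply, idempotentModuleHom_comp, serreFunctional_idempotentModuleHom]

/-- The homomorphism `Y → e A^*` given by a functional `ψ` on `Hom(e A, Y)`: it sends `y` to the
functional `x ↦ ψ (a ↦ y x a)`. -/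
def serreModuleHom {Y : ModuleCat.{max u v} Aᵐᵒᵖ} (ψ : Module.Dual k (idempotentModule e ⟶ Y)) :
    Y ⟶ serreModule.{u, v} k e :=
  let dualOf (y : Y) : serreIdeal k e :=
    { val :=
        { toFun x := ψ (idempotentModuleHom e (op x • y))
          map_add' x x' := by
            rw [MulOpposite.op_add, add_smul, idempotentModuleHom_add, map_add]
          map_smul' c x := by rw [idempotentModuleHom_smul_op_smul, map_smul, RingHom.id_apply] }
      property x := congrArg ψ <| by rw [op_mul, mul_smul, idempotentModuleHom_op_smul_self] }
  ModuleCat.ofHom (Y := serreIdeal k e)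
    { toFun := dualOf
      map_add' y y' := Subtype.ext <| DFunLike.ext _ _ fun x =>
        (congrArg ψ (by rw [smul_add, idempotentModuleHom_add])).trans (map_add ψ _ _)
      map_smul' b y := Subtype.ext <| DFunLike.ext _ _ fun x =>
        congrArg (ψ <| idempotentModuleHom e ·) (mul_smul (op x) b y).symm }

theorem toDual_serreModuleHom {Y : ModuleCat.{max u v} Aᵐᵒᵖ}
    (ψ : Module.Dual k (idempotentModule e ⟶ Y)) (y : Y) (x : A) :
    serreModule.toDual ((serreModuleHom ψ).hom y) x = ψ (idempotentModuleHom e (op x • y)) := rfl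

theorem serrePairing_serreFunctional_bijective (he : IsIdempotentElem e)
    (Y : ModuleCat.{max u v} Aᵐᵒᵖ) :
    Function.Bijective (serrePairing (serreFunctional.{u, v} (k := k) he) Y) := by
  constructor
  · rw [injective_iff_map_eq_zero]
    refine fun g hg => ModuleCat.hom_ext <| LinearMap.ext fun y => Subtype.ext <|
      DFunLike.ext _ _ fun x => ?_
    calc serreModule.toDual (g.hom y) x = serreModule.toDual (g.hom (op x • y)) 1 := by
          rw [map_smul]
          exact congrArg (serreModule.toDual (g.hom y)) (mul_one x).symm
      _ = 0 := by rw [← serrePairing_serreFunctional_apply he, hg, LinearMap.zero_apply]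
  · refine fun ψ => ⟨serreModuleHom ψ, LinearMap.ext fun u => ?_⟩
    rw [← idempotentModuleHom_imageOfIdempotent he u, serrePairing_serreFunctional_apply,
      toDual_serreModuleHom, op_one, one_smul]

end SerreModule

theorem subsingleton_shift_hom_iff {T : Type v} [Category.{w} T] [HasShift T ℤ] (X Y : T)
    (n : ℤ) : Subsingleton (X⟦n⟧ ⟶ Y) ↔ Subsingleton (X ⟶ Y⟦-n⟧) :=
  ((shiftEquiv T n).toAdjunction.homEquiv X Y).subsingleton_congr

namespace IsDirectedFamily

variable {k : Type u} [Field k] {A : Type (max u v)} [Ring A] [Algebra k A]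
  [FiniteDimensional k A] {V : Type w} [Fintype V] [LinearOrder V] {e : V → A}
  (he : IsDirectedFamily k e) [HasDerivedCategory.{u'} (ModuleCat.{max u v} Aᵐᵒᵖ)]

include he

theorem hasSerreDual_idempotentModule (i : V) :
    HasSerreDual k (isPerfect A) ((DerivedCategory.singleFunctor _ 0).obj
      (idempotentModule (e i))) := by
  have := isArtinianRing_op k A
  have hproj (j : V) : Projective (idempotentModule (e j)) :=
    (IsProjective.iff_projective _).1 (projective_idempotentIdeal (he.idem j))
  let E := serreModule.{u, v} k (e i)
  have hE : Module.Finite Aᵐᵒᵖ E := inferInstanceAs (Module.Finite Aᵐᵒᵖ (serreIdeal k (e i)))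
  refine ⟨(DerivedCategory.singleFunctor _ 0).obj E,
    mapFunctional (DerivedCategory.singleFunctor _ 0) (serreFunctional.{u, v} (he.idem i)),
    he.isPerfect_single_of_finite E, fun Y hY => ?_⟩
  refine serrePairingPerfect.bijective (he.isPerfect_le _ (fun j n => ?_) Y hY)
  rcases eq_or_ne n 0 with rfl | hn
  · exact serrePairing_bijective_of_iso _ ((shiftFunctorZero _ ℤ).symm.app _)
      (serrePairing_mapFunctional_bijective _ _
        (serrePairing_serreFunctional_bijective (he.idem i) _))
  · have := subsingleton_hom_single_shift_of_projective
      (idempotentModule (e i)) (idempotentModule (e j)) hn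
    have := (subsingleton_shift_hom_iff _ _ n).2 (subsingleton_hom_single_shift_of_projective
      (idempotentModule (e j)) E (neg_ne_zero.2 hn))
    exact ⟨Function.injective_of_subsingleton _, fun f =>
      ⟨0, LinearMap.ext fun g => by rw [Subsingleton.elim g 0, map_zero, map_zero]⟩⟩

theorem nonempty_serreFunctor_perf : Nonempty (SerreFunctor k (Perf A)) :=
  have := isArtinianRing_op k A
  nonempty_serreFunctor (isPerfect A)
    (he.isPerfect_le (HasSerreDual k (isPerfect A)) he.hasSerreDual_idempotentModule)
    fun _ _ hX hY => finiteDimensional_hom_of_isPerfect k hX hY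

end IsDirectedFamily

/-! ### The canonical t-structure and a projective separator -/

section ProjectiveSeparator

variable {C : Type u} [Category.{v} C] [Abelian C] {P : C}

theorem exact_of_isSeparator (hP : IsSeparator P) (S : ShortComplex C)
    (h : ∀ z : P ⟶ S.X₂, z ≫ S.g = 0 → ∃ y : P ⟶ S.X₁, y ≫ S.f = z) : S.Exact := by
  rw [S.exact_iff_epi_toCycles]
  refine Preadditive.epi_of_cancel_zero _ fun u hu => ?_
  refine (Preadditive.isSeparator_iff P).1 hP u fun c => ?_
  obtain ⟨y, hy⟩ := h (c ≫ S.iCycles) (by rw [Category.assoc, S.iCycles_g, comp_zero])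
  have hc : y ≫ S.toCycles = c := by rw [← cancel_mono S.iCycles, Category.assoc, S.toCycles_i, hy]
  rw [← hc, Category.assoc, hu, comp_zero]

/-- The morphism of complexes from `P`, placed in degree `n`, given by a cycle of degree `n`. -/
def cycleHom {K : CochainComplex C ℤ} {n : ℤ} (z : P ⟶ K.X n) (hz : z ≫ K.d n (n + 1) = 0) :
    (HomologicalComplex.single C (ComplexShape.up ℤ) n).obj P ⟶ K :=
  HomologicalComplex.mkHomFromSingle z (by rintro j rfl; exact hz)

theorem cycleHom_f {K : CochainComplex C ℤ} {n : ℤ} (z : P ⟶ K.X n)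
    (hz : z ≫ K.d n (n + 1) = 0) :
    (cycleHom z hz).f n =
      (HomologicalComplex.singleObjXSelf (ComplexShape.up ℤ) n P).hom ≫ z :=
  HomologicalComplex.mkHomFromSingle_f _ _

theorem isKProjective_single (P : C) [Projective P] (n : ℤ) : CochainComplex.IsKProjective
    ((HomologicalComplex.single C (ComplexShape.up ℤ) n).obj P) := by
  have (i : ℤ) : Projective (((HomologicalComplex.single C (ComplexShape.up ℤ) n).obj P).X i) := by
    rcases eq_or_ne i n with rfl | hi
    · exact Projective.of_iso (HomologicalComplex.singleObjXSelf _ i P).symm inferInstance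
    · exact Projective.of_iso (HomologicalComplex.isZero_single_obj_X _ _ _ _ hi).isoZero.symm
        inferInstance
  have : CochainComplex.IsStrictlyLE
      ((HomologicalComplex.single C (ComplexShape.up ℤ) n).obj P) n :=
    inferInstanceAs (((CochainComplex.singleFunctor C n).obj P).IsStrictlyLE n)
  exact CochainComplex.isKProjective_of_projective _ n

variable [HasDerivedCategory.{w} C]

theorem exists_comp_d_eq_of_Q_map_cycleHom_eq_zero [Projective P] {K : CochainComplex C ℤ} {n : ℤ}
    {z : P ⟶ K.X n} {hz : z ≫ K.d n (n + 1) = 0}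
    (h : DerivedCategory.Q.map (cycleHom z hz) = 0) :
    ∃ y : P ⟶ K.X (n - 1), y ≫ K.d (n - 1) n = z := by
  have := isKProjective_single P n
  obtain ⟨H⟩ := nonempty_homotopy_zero_of_Q_map_eq_zero _ h
  have hn := H.comm n
  rw [dNext_eq H.hom (show (ComplexShape.up ℤ).Rel n (n + 1) from rfl),
    prevD_eq H.hom (show (ComplexShape.up ℤ).Rel (n - 1) n by simp),
    HomologicalComplex.single_obj_d, zero_comp, zero_add, HomologicalComplex.zero_f, add_zero,
    cycleHom_f, ← Iso.eq_inv_comp] at hn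
  exact ⟨_, (Category.assoc _ _ _).trans hn.symm⟩

theorem hom_single_eq_zero_of_isLE [Projective P] {X : DerivedCategory C} {n i : ℤ} (hi : n < i)
    (hX : X.IsLE n) (f : (DerivedCategory.singleFunctor C i).obj P ⟶ X) : f = 0 := by
  obtain ⟨K, _, ⟨e⟩⟩ := X.exists_iso_Q_obj_of_isLE n
  rw [← cancel_mono e.hom, zero_comp]
  exact DerivedCategory.from_singleFunctor_obj_eq_zero_of_projective (f ≫ e.hom) n hi

theorem isLE_of_hom_single_eq_zero [Projective P] (hP : IsSeparator P) {X : DerivedCategory C}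
    {n : ℤ} (hX : ∀ i, n < i → ∀ f : (DerivedCategory.singleFunctor C i).obj P ⟶ X, f = 0) :
    X.IsLE n := by
  obtain ⟨K, ⟨e⟩⟩ : ∃ K, Nonempty (DerivedCategory.Q.obj K ≅ X) :=
    ⟨_, ⟨DerivedCategory.Q.objObjPreimageIso X⟩⟩
  have : K.IsLE n := by
    rw [CochainComplex.isLE_iff]
    intro i hi
    rw [HomologicalComplex.exactAt_iff' K (i - 1) i (i + 1) (by simp) (by simp)]
    refine exact_of_isSeparator hP _ fun z hz =>
      exists_comp_d_eq_of_Q_map_cycleHom_eq_zero (hz := hz) ?_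
    rw [← cancel_mono e.hom, zero_comp]
    exact hX i hi _
  have : (DerivedCategory.Q.obj K).IsLE n := inferInstance
  exact DerivedCategory.TStructure.t.isLE_of_iso e n

theorem eq_zero_of_Q_map_single_eq_zero {M N : C} {n : ℤ}
    {f : (CochainComplex.singleFunctor C n).obj M ⟶ (CochainComplex.singleFunctor C n).obj N}
    (hf : DerivedCategory.Q.map f = 0) : f = 0 := by
  obtain ⟨φ, rfl⟩ := (CochainComplex.singleFunctor C n).map_surjective f
  have hφ : φ = 0 := (DerivedCategory.singleFunctor C n).map_injective <| by
    rw [Functor.map_zero]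
    exact hf
  rw [hφ, Functor.map_zero]

theorem eq_zero_of_Q_map_cycleHom_comp_eq_zero (hP : IsSeparator P) {n : ℤ}
    {K : CochainComplex C ℤ} [K.IsStrictlyLE n] {M : C}
    {g : K ⟶ (CochainComplex.singleFunctor C n).obj M}
    (hg : ∀ (z : P ⟶ K.X n) (hz : z ≫ K.d n (n + 1) = 0),
      DerivedCategory.Q.map (cycleHom z hz ≫ g) = 0) : g = 0 := by
  refine HomologicalComplex.to_single_hom_ext <| (Preadditive.isSeparator_iff P).1 hP _ fun z => ?_
  have hz : z ≫ K.d n (n + 1) = 0 :=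
    (K.isZero_of_isStrictlyLE n (n + 1) (by lia)).eq_of_tgt _ _
  have hfn : (cycleHom z hz).f n ≫ g.f n = 0 :=
    congrArg (fun f => HomologicalComplex.Hom.f f n) (eq_zero_of_Q_map_single_eq_zero (hg z hz))
  rwa [cycleHom_f, Category.assoc, ← cancel_epi (HomologicalComplex.singleObjXSelf _ n P).inv,
    Iso.inv_hom_id_assoc, comp_zero] at hfn

theorem eq_zero_of_single_comp_eq_zero (hP : IsSeparator P) {X : DerivedCategory C} {n : ℤ}
    (hX : X.IsLE n) {M : C} {g : X ⟶ (DerivedCategory.singleFunctor C n).obj M}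
    (hg : ∀ x : (DerivedCategory.singleFunctor C n).obj P ⟶ X, x ≫ g = 0) : g = 0 := by
  obtain ⟨K, _, ⟨e⟩⟩ := X.exists_iso_Q_obj_of_isLE n
  obtain ⟨g, rfl⟩ : ∃ g' : DerivedCategory.Q.obj K ⟶
      DerivedCategory.Q.obj ((CochainComplex.singleFunctor C n).obj M), g = e.hom ≫ g' :=
    ⟨e.inv ≫ g, (e.hom_inv_id_assoc g).symm⟩
  obtain ⟨L, _, s, _, g, rfl⟩ := DerivedCategory.right_fac_of_isStrictlyLE g n
  have hg0 : g = 0 := eq_zero_of_Q_map_cycleHom_comp_eq_zero hP fun z hz => by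
    have h : (DerivedCategory.Q.map (cycleHom z hz ≫ s) ≫ e.inv) ≫ e.hom ≫
        inv (DerivedCategory.Q.map s) ≫ DerivedCategory.Q.map g = 0 := hg _
    rwa [Category.assoc, e.inv_hom_id_assoc, Functor.map_comp, Category.assoc,
      IsIso.hom_inv_id_assoc, ← Functor.map_comp] at h
  have h : inv (DerivedCategory.Q.map s) ≫ DerivedCategory.Q.map g = 0 := by
    rw [hg0, Functor.map_zero, comp_zero]
  exact (congrArg (e.hom ≫ ·) h).trans comp_zero

end ProjectiveSeparator

section PerfectBounds

variable {A : Type v} [Ring A]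

theorem isSeparator_regularModule : IsSeparator (regularModule A) :=
  (Preadditive.isSeparator_iff _).2 fun {M N} f hf => ModuleCat.hom_ext <| LinearMap.ext fun m => by
    have h := congrArg (fun g : regularModule A ⟶ N => g.hom (1 : A))
      (hf (ModuleCat.ofHom (toSpanSingletonOp m)))
    exact (congrArg f.hom (one_smul Aᵐᵒᵖ m)).symm.trans h

variable [HasDerivedCategory.{u'} (ModuleCat.{v} Aᵐᵒᵖ)]
  {X : DerivedCategory (ModuleCat.{v} Aᵐᵒᵖ)}

theorem exists_isLE_of_isPerfect (hX : isPerfect A X) : ∃ n, X.IsLE n := by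
  obtain ⟨K, ⟨a, b, hK⟩, _, ⟨e⟩⟩ := hX
  have : K.IsStrictlyLE b := (K.isStrictlyLE_iff b).2 fun i hi => hK i (Or.inr hi)
  have : (DerivedCategory.Q.obj K).IsLE b := inferInstance
  exact ⟨b, DerivedCategory.TStructure.t.isLE_of_iso e.symm b⟩

theorem exists_hom_eq_zero_of_isPerfect (hX : isPerfect A X) :
    ∃ a : ℤ, ∀ (Y : DerivedCategory (ModuleCat.{v} Aᵐᵒᵖ)) (n : ℤ),
      n < a → Y.IsLE n → ∀ f : X ⟶ Y, f = 0 := by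
  obtain ⟨K, ⟨a, b, hK⟩, hK', ⟨e⟩⟩ := hX
  refine ⟨a, fun Y n hn hY f => ?_⟩
  have := isKProjective_of_projective_of_isZero K b (fun i hi => hK i (Or.inr hi)) fun i =>
    (hK' i).2
  obtain ⟨L, hL, ⟨e'⟩⟩ := Y.exists_iso_Q_obj_of_isLE n
  obtain ⟨g, hg⟩ := exists_Q_map_eq_of_isKProjective (e.inv ≫ f ≫ e'.hom)
  have hg0 : g = 0 := by
    ext i : 1
    rcases lt_or_ge i a with hi | hi
    · exact (hK i (Or.inl hi)).eq_of_src _ _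
    · exact (L.isZero_of_isStrictlyLE n i (by lia)).eq_of_tgt _ _
  rw [hg0, Functor.map_zero] at hg
  rw [← cancel_mono e'.hom, ← cancel_epi e.inv, ← hg, zero_comp, comp_zero]

end PerfectBounds

/-! ### Iterates of Serre functors -/

namespace SerreFunctor

variable {k : Type*} [Field k] {T : Type*} [Category T] [Preadditive T] [Linear k T]
  (S : SerreFunctor k T)

theorem eq_zero_of_duality_eq_zero {X Y : T} (h : Y ⟶ S.functor.obj X)
    (hh : ∀ g : X ⟶ Y, S.duality X Y g h = 0) : h = 0 := by
  refine (Module.forall_dual_apply_eq_zero_iff k h).1 fun φ => ?_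
  obtain ⟨g, rfl⟩ := (S.duality X Y).surjective φ
  exact hh g

theorem duality_map {X X' : T} (f : X' ⟶ X) (g : X ⟶ S.functor.obj X') :
    S.duality X _ g (S.functor.map f) = S.duality X' _ (f ≫ g) (𝟙 _) := by
  rw [S.naturality_left, Category.id_comp]

instance : S.functor.Additive where
  map_add {X Y f g} := by
    refine sub_eq_zero.1 (S.eq_zero_of_duality_eq_zero _ fun h => ?_)
    simp [duality_map]

instance : S.functor.Linear k where
  map_smul {X Y} f r := by
    refine sub_eq_zero.1 (S.eq_zero_of_duality_eq_zero _ fun h => ?_)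
    simp [duality_map]

theorem span_comp_map_eq_top {R X : T}
    (hX : ∀ g : X ⟶ R, (∀ x : R ⟶ X, x ≫ g = 0) → g = 0) :
    Submodule.span k
      (Set.range fun p : (R ⟶ S.functor.obj R) × (R ⟶ X) => p.1 ≫ S.functor.map p.2) = ⊤ := by
  by_contra hne
  obtain ⟨φ, hφ, hle⟩ := Submodule.exists_le_ker_of_lt_top _ (lt_top_iff_ne_top.2 hne)
  obtain ⟨g, rfl⟩ := (S.duality X R).surjective φ
  refine hφ ?_
  rw [hX g fun x => ?_, map_zero]
  refine (S.duality R R).injective (LinearMap.ext fun f => ?_)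
  rw [S.naturality_left, map_zero, LinearMap.zero_apply]
  exact hle (Submodule.subset_span ⟨(f, x), rfl⟩)

variable {A : Type*} [Ring A] [Algebra k A] [FiniteDimensional k A] {R : T} (ρ : A ≃ₗ[k] (R ⟶ R))

/-- The identification of the morphisms `R ⟶ S R` with the Serre bimodule of the endomorphism
algebra `A` of `R`. -/
def serreBimoduleEquiv : (R ⟶ S.functor.obj R) ≃ₗ[k] SerreBimodule k A :=
  .ofBijective ((S.duality R R).toLinearMap ∘ₗ ρ.toLinearMap).flip <| by
    have : FiniteDimensional k (Module.Dual k (R ⟶ S.functor.obj R)) :=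
      (ρ.trans (S.duality R R)).finiteDimensional
    have : FiniteDimensional k (R ⟶ S.functor.obj R) := (Module.finite_dual_iff k).1 this
    exact (LinearMap.IsPerfPair.of_bijective _
      (ρ.trans (S.duality R R)).bijective).bijective_right

theorem serreBimoduleEquiv_apply (f : R ⟶ S.functor.obj R) (a : A) :
    S.serreBimoduleEquiv ρ f a = S.duality R R (ρ a) f := rfl

/-- The morphism `f ≫ S x : R ⟶ S X` for `x : R ⟶ X` and an element `f` of the Serre bimodule,
viewed as a morphism `R ⟶ S R`. -/
def compMap (X : T) : (R ⟶ X) →ₗ[k] SerreBimodule k A →ₗ[k] (R ⟶ S.functor.obj X) :=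
  ((Linear.comp R (S.functor.obj R) (S.functor.obj X)).flip ∘ₗ S.functor.mapLinearMap k).compl₂
    (S.serreBimoduleEquiv ρ).symm.toLinearMap

theorem compMap_apply {X : T} (x : R ⟶ X) (f : SerreBimodule k A) :
    S.compMap ρ X x f = (S.serreBimoduleEquiv ρ).symm f ≫ S.functor.map x := rfl

/-- The morphism `R ⟶ S^m X` given by a morphism `x : R ⟶ X` and `m` elements of the Serre
bimodule; the element with index `0` is the one next to `x`. -/
def iterHom : (m : ℕ) → (X : T) → (R ⟶ X) →ₗ[k]
    MultilinearMap k (fun _ : Fin m => SerreBimodule k A) (R ⟶ S.functor.obj^[m] X)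
  | 0, X => (MultilinearMap.constLinearEquivOfIsEmpty (R := k) (S := k)
      (M₁ := fun _ : Fin 0 => SerreBimodule k A) (M₂ := R ⟶ X)).toLinearMap
  | m + 1, X =>
    (multilinearCurryLeftEquiv k (fun _ : Fin (m + 1) => SerreBimodule k A) _).symm.toLinearMap ∘ₗ
      (S.compMap ρ X).compr₂ (iterHom m (S.functor.obj X))

theorem iterHom_succ (m : ℕ) {X : T} (x : R ⟶ X) (f : Fin (m + 1) → SerreBimodule k A) :
    S.iterHom ρ (m + 1) X x f =
      S.iterHom ρ m (S.functor.obj X) (S.compMap ρ X x (f 0)) (Fin.tail f) := rfl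

theorem subsingleton_hom_of_iterHom_eq_zero {m : ℕ} {X : T}
    (hX : ∀ (n : ℕ) (g : S.functor.obj^[n] X ⟶ R),
      (∀ x : R ⟶ S.functor.obj^[n] X, x ≫ g = 0) → g = 0)
    (hm : S.iterHom ρ m X = 0) : Subsingleton (R ⟶ S.functor.obj^[m] X) := by
  induction m generalizing X with
  | zero => exact subsingleton_of_forall_eq 0 fun x => congrArg (fun F => F x Fin.elim0) hm
  | succ m ih =>
    refine ih (X := S.functor.obj X) (fun n => hX (n + 1)) ?_
    refine LinearMap.ext_on_range (S.span_comp_map_eq_top (hX 0)) ?_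
    rintro ⟨f, x⟩
    ext g
    have h := congrArg (fun F => F x (Fin.cons (S.serreBimoduleEquiv ρ f) g)) hm
    rwa [iterHom_succ, compMap_apply, Fin.cons_zero, Fin.tail_cons,
      LinearEquiv.symm_apply_apply] at h

section

variable (hρ : ∀ a b, ρ (b * a) = ρ a ≫ ρ b)
include hρ

theorem serreBimoduleEquiv_symm_smul (a : A) (f : SerreBimodule k A) :
    (S.serreBimoduleEquiv ρ).symm (a • f) =
      (S.serreBimoduleEquiv ρ).symm f ≫ S.functor.map (ρ a) := by
  rw [LinearEquiv.symm_apply_eq]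
  refine DFunLike.ext _ _ fun x => ?_
  rw [SerreBimodule.smul_apply, serreBimoduleEquiv_apply, ← S.naturality_left, ← hρ,
    ← serreBimoduleEquiv_apply, LinearEquiv.apply_symm_apply]

theorem serreBimoduleEquiv_symm_op_smul (a : A) (f : SerreBimodule k A) :
    (S.serreBimoduleEquiv ρ).symm (op a • f) = ρ a ≫ (S.serreBimoduleEquiv ρ).symm f := by
  rw [LinearEquiv.symm_apply_eq]
  refine DFunLike.ext _ _ fun x => ?_
  rw [SerreBimodule.op_smul_apply, serreBimoduleEquiv_apply, ← S.naturality_right, ← hρ,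
    ← serreBimoduleEquiv_apply, LinearEquiv.apply_symm_apply]

theorem compMap_compMap_op_smul {X : T} (x : R ⟶ X) (a : A) (f g : SerreBimodule k A) :
    S.compMap ρ _ (S.compMap ρ X x (op a • f)) g =
      S.compMap ρ _ (S.compMap ρ X x f) (a • g) := by
  simp only [compMap_apply, S.serreBimoduleEquiv_symm_op_smul ρ hρ,
    S.serreBimoduleEquiv_symm_smul ρ hρ, Functor.map_comp, Category.assoc]

theorem iterHom_update_op_smul {m : ℕ} {X : T} (x : R ⟶ X) (f : Fin m → SerreBimodule k A)
    {i j : Fin m} (hij : (j : ℕ) = i + 1) (a : A) :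
    S.iterHom ρ m X x (Function.update f i (op a • f i)) =
      S.iterHom ρ m X x (Function.update f j (a • f j)) := by
  induction m generalizing X with
  | zero => exact i.elim0
  | succ m ih =>
    obtain ⟨j, rfl⟩ := Fin.exists_succ_eq.2 (show j ≠ 0 by rintro rfl; simp at hij)
    rw [iterHom_succ, iterHom_succ, Fin.tail_update_succ,
      Function.update_of_ne (Fin.succ_ne_zero j).symm]
    induction i using Fin.cases with
    | zero =>
      cases m with
      | zero => exact j.elim0
      | succ m =>
        obtain rfl : j = 0 := by ext; simpa using hij
        rw [Fin.tail_update_zero, Function.update_self, iterHom_succ, iterHom_succ,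
          Fin.tail_update_zero, Function.update_self]
        exact congrArg (S.iterHom ρ m _ · _) (S.compMap_compMap_op_smul ρ hρ x a _ _)
    | succ i =>
      rw [Fin.tail_update_succ, Function.update_of_ne (Fin.succ_ne_zero i).symm]
      exact ih _ (Fin.tail f) (by simpa using hij)

theorem iterHom_eq_zero_of_subsingleton_bimoduleTensorPower {m : ℕ}
    (hm : Subsingleton (BimoduleTensorPower k A (SerreBimodule k A) m)) (X : T) :
    S.iterHom ρ m X = 0 := by
  ext x f
  have hle : balancedRelations k A (SerreBimodule k A) m ≤
      LinearMap.ker (PiTensorProduct.lift (S.iterHom ρ m X x)) := by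
    refine Submodule.span_le.2 ?_
    rintro _ ⟨f, i, j, a, hij, rfl⟩
    rw [SetLike.mem_coe, LinearMap.mem_ker, map_sub, PiTensorProduct.lift.tprod,
      PiTensorProduct.lift.tprod, S.iterHom_update_op_smul ρ hρ x f hij, sub_self]
  rw [Submodule.Quotient.subsingleton_iff.1 hm] at hle
  simpa using hle (Submodule.mem_top (x := PiTensorProduct.tprod k f))

theorem subsingleton_hom_iterate {m : ℕ} {X : T}
    (hX : ∀ (n : ℕ) (g : S.functor.obj^[n] X ⟶ R),
      (∀ x : R ⟶ S.functor.obj^[n] X, x ≫ g = 0) → g = 0)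
    (hm : Subsingleton (BimoduleTensorPower k A (SerreBimodule k A) m)) :
    Subsingleton (R ⟶ S.functor.obj^[m] X) :=
  S.subsingleton_hom_of_iterHom_eq_zero ρ hX
    (S.iterHom_eq_zero_of_subsingleton_bimoduleTensorPower ρ hρ hm X)

end

end SerreFunctor

/-! ### The lower Serre dimension -/

theorem one_div_le_liminf_neg_div {s : ℕ → EReal} {c : ℝ} {r : ℕ} (hr : 0 < r)
    (hs : ∀ m, s m ≤ ((c - (m / r : ℕ) : ℝ) : EReal)) :
    ((1 / (r : ℝ) : ℝ) : EReal) ≤ liminf (fun m : ℕ => -s m / (m : EReal)) atTop := by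
  have hlim : Tendsto (fun m : ℕ => (1 / (r : ℝ) - (1 + c) / m : ℝ)) atTop
      (nhds (1 / (r : ℝ))) := by
    simpa using (tendsto_const_div_atTop_nhds_zero_nat (1 + c)).const_sub (1 / (r : ℝ))
  rw [← (EReal.tendsto_coe.2 hlim).liminf_eq]
  refine liminf_le_liminf ?_
  filter_upwards [eventually_gt_atTop 0] with m hm
  have hm' : (0 : ℝ) < m := Nat.cast_pos.2 hm
  have hr' : (0 : ℝ) < r := Nat.cast_pos.2 hr
  have hfloor : (m : ℝ) / r < (m / r : ℕ) + 1 := by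
    rw [div_lt_iff₀' hr']
    exact_mod_cast Nat.lt_mul_div_succ m hr
  calc ((1 / (r : ℝ) - (1 + c) / m : ℝ) : EReal)
      ≤ ((-(c - (m / r : ℕ)) / m : ℝ) : EReal) := by
        rw [EReal.coe_le_coe_iff, le_div_iff₀ hm', sub_mul, div_mul_cancel₀ _ hm'.ne',
          one_div_mul_eq_div]
        linarith
    _ = -((c - (m / r : ℕ) : ℝ) : EReal) / (m : EReal) := by
        rw [EReal.coe_div, EReal.coe_neg, EReal.coe_natCast]
    _ ≤ -s m / (m : EReal) :=
        EReal.div_le_div_right_of_nonneg (by positivity) (EReal.neg_le_neg_iff.2 (hs m))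

section Perf

variable {A : Type v} [Ring A] [HasDerivedCategory.{u'} (ModuleCat.{v} Aᵐᵒᵖ)]

theorem exists_supHom_le_of_isLE (X : Perf A) :
    ∃ a : ℤ, ∀ (Y : Perf A) (n : ℤ), Y.obj.IsLE n → supHom X Y ≤ ((n - a : ℝ) : EReal) := by
  obtain ⟨a, ha⟩ := exists_hom_eq_zero_of_isPerfect X.property
  refine ⟨a, fun Y n hY => sSup_le ?_⟩
  rintro _ ⟨i, hi, rfl⟩
  by_contra hlt
  have hlt' : n - a < i := by
    rw [not_le, EReal.coe_lt_coe_iff] at hlt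
    exact_mod_cast hlt
  have hshift := DerivedCategory.TStructure.t.isLE_shift Y.obj n i (n - i) (by lia)
  exact not_subsingleton_iff_nontrivial.2 hi
    (subsingleton_of_forall_eq 0 (ha _ _ (by lia) hshift))

variable {k : Type u} [Field k] [Algebra k A]

variable (k) in
/-- The elements of an algebra are the endomorphisms of its regular module in degree `n`. -/
def regularPerfEnd (n : ℤ) : A ≃ₗ[k] (regularPerf A n ⟶ regularPerf A n) :=
  (regularModuleEnd k A).trans <|
    (homLinearEquivOfFullyFaithful k (DerivedCategory.singleFunctor _ n) _ _).trans
      (homLinearEquivOfFullyFaithful k (isPerfect A).ι (regularPerf A n) (regularPerf A n)).symm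

theorem regularPerfEnd_hom (n : ℤ) (a : A) : (regularPerfEnd k n a).hom =
    (DerivedCategory.singleFunctor _ n).map (regularModuleEnd k A a) :=
  (homLinearEquivOfFullyFaithful k (isPerfect A).ι (regularPerf A n)
    (regularPerf A n)).apply_symm_apply _

theorem regularPerfEnd_mul (n : ℤ) (a b : A) :
    regularPerfEnd k n (b * a) = regularPerfEnd k n a ≫ regularPerfEnd k n b := by
  apply ObjectProperty.hom_ext
  refine (regularPerfEnd_hom n _).trans ?_
  rw [regularModuleEnd_mul, Functor.map_comp, ← regularPerfEnd_hom, ← regularPerfEnd_hom]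
  rfl

namespace SerreFunctor

variable (S : SerreFunctor k (Perf A)) {X : Perf A} {n : ℤ}

theorem isLE_obj (hX : X.obj.IsLE n) : (S.functor.obj X).obj.IsLE n := by
  refine isLE_of_hom_single_eq_zero isSeparator_regularModule fun i hi f => ?_
  suffices (ObjectProperty.homMk f : regularPerf A i ⟶ S.functor.obj X) = 0 from
    congrArg (·.hom) this
  refine S.eq_zero_of_duality_eq_zero _ fun g => ?_
  have hg : g = 0 := ObjectProperty.hom_ext _ <|
    DerivedCategory.TStructure.t.zero_of_isLE_of_isGE g.hom n i hi hX
      (inferInstanceAs (((DerivedCategory.singleFunctor _ i).obj (regularModule A)).IsGE i))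
  rw [hg, map_zero, LinearMap.zero_apply]

theorem isLE_iterate (hX : X.obj.IsLE n) (m : ℕ) : (S.functor.obj^[m] X).obj.IsLE n := by
  induction m generalizing X with
  | zero => exact hX
  | succ _ ih => exact ih (S.isLE_obj hX)

variable [FiniteDimensional k A] {r : ℕ}
  (hr : Subsingleton (BimoduleTensorPower k A (SerreBimodule k A) r))
include hr

theorem isLE_iterate_sub_one (hX : X.obj.IsLE n) :
    (S.functor.obj^[r] X).obj.IsLE (n - 1) := by
  refine isLE_of_hom_single_eq_zero isSeparator_regularModule fun i hi f => ?_
  rcases (show n ≤ i by lia).lt_or_eq with hi' | rfl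
  · exact hom_single_eq_zero_of_isLE hi' (S.isLE_iterate hX r) f
  have : Subsingleton (regularPerf A n ⟶ S.functor.obj^[r] X) := by
    refine S.subsingleton_hom_iterate (regularPerfEnd k n) (regularPerfEnd_mul n)
      (fun _ g hg => ObjectProperty.hom_ext _ ?_) hr
    exact eq_zero_of_single_comp_eq_zero isSeparator_regularModule (S.isLE_iterate hX _)
      fun x => congrArg (·.hom) (hg (ObjectProperty.homMk x))
  exact congrArg (·.hom)
    (Subsingleton.elim (ObjectProperty.homMk f : regularPerf A n ⟶ S.functor.obj^[r] X) 0)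

theorem isLE_iterate_mul (hX : X.obj.IsLE n) (j : ℕ) :
    (S.functor.obj^[r * j] X).obj.IsLE (n - j) := by
  induction j with
  | zero => simpa using hX
  | succ j ih =>
    rw [Nat.mul_succ, add_comm, Function.iterate_add_apply, Nat.cast_succ, ← sub_sub]
    exact S.isLE_iterate_sub_one hr ih

theorem isLE_iterate_div (hX : X.obj.IsLE n) (m : ℕ) :
    (S.functor.obj^[m] X).obj.IsLE (n - (m / r : ℕ)) := by
  have h := S.isLE_iterate (S.isLE_iterate_mul hr hX (m / r)) (m % r)
  rwa [← Function.iterate_add_apply, Nat.mod_add_div] at h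

theorem one_div_le_LSdim (hr0 : 0 < r) (G : Perf A) :
    ((1 / (r : ℝ) : ℝ) : EReal) ≤ LSdim S.functor G := by
  obtain ⟨n, hn⟩ := exists_isLE_of_isPerfect G.property
  obtain ⟨a, ha⟩ := exists_supHom_le_of_isLE G
  refine one_div_le_liminf_neg_div (c := n - a) hr0 fun m => ?_
  have h := ha _ _ (S.isLE_iterate_div hr hn m)
  rwa [Int.cast_sub, Int.cast_natCast, sub_right_comm] at h

end SerreFunctor

end Perf

/-! ### Vanishing of tensor powers of bimodules -/

section TensorPower

variable {k : Type*} [Field k] {A : Type*} [Ring A] {B : Type*} [AddCommGroup B] [Module k B]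
  [Module A B] [Module Aᵐᵒᵖ B]

variable (k A B) in
/-- The pure tensors in a tensor power of a bimodule. -/
def bimoduleTprod (n : ℕ) :
    MultilinearMap k (fun _ : Fin n => B) (BimoduleTensorPower k A B n) :=
  (balancedRelations k A B n).mkQ.compMultilinearMap (PiTensorProduct.tprod k)

theorem subsingleton_bimoduleTensorPower_of_bimoduleTprod_eq_zero {n : ℕ}
    (h : ∀ f, bimoduleTprod k A B n f = 0) : Subsingleton (BimoduleTensorPower k A B n) := by
  rw [Submodule.Quotient.subsingleton_iff, eq_top_iff, ← PiTensorProduct.span_tprod_eq_top,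
    Submodule.span_le]
  rintro _ ⟨f, rfl⟩
  exact (Submodule.Quotient.mk_eq_zero _).1 (h f)

theorem bimoduleTprod_update_op_smul_self {n : ℕ} (f : Fin n → B) {p q : Fin n}
    (hpq : (q : ℕ) = p + 1) (a : A) :
    bimoduleTprod k A B n (Function.update f p (op a • f p)) =
      bimoduleTprod k A B n (Function.update f q (a • f q)) :=
  (Submodule.Quotient.eq _).2 (Submodule.subset_span ⟨f, p, q, a, hpq, rfl⟩)

theorem bimoduleTprod_update_op_smul {n : ℕ} (f : Fin n → B) {p q : Fin n}
    (hpq : (q : ℕ) = p + 1) (a : A) (g : B) :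
    bimoduleTprod k A B n (Function.update f p (op a • g)) =
      bimoduleTprod k A B n (Function.update (Function.update f p g) q (a • f q)) := by
  have hne : q ≠ p := fun h => by simp [h] at hpq
  have h := bimoduleTprod_update_op_smul_self (k := k) (Function.update f p g) hpq a
  rwa [Function.update_self, Function.update_idem, Function.update_of_ne hne] at h

theorem bimoduleTprod_eq_zero_of_op_smul_eq_zero {n : ℕ} {f : Fin n → B} {p q : Fin n}
    (hpq : (q : ℕ) = p + 1) {e a : A} (hep : op e • f p = f p) (hap : op a • f p = 0)
    (heq : ∃ h : B, e • f q = a • h) : bimoduleTprod k A B n f = 0 := by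
  obtain ⟨h, hh⟩ := heq
  have hne : p ≠ q := fun h => by simp [h] at hpq
  have hmove := bimoduleTprod_update_op_smul_self (k := k) f hpq e
  have hback := bimoduleTprod_update_op_smul_self (k := k) (Function.update f q h) hpq a
  rw [hep, Function.update_eq_self, hh] at hmove
  rw [Function.update_self, Function.update_idem, Function.update_of_ne hne, hap] at hback
  rw [hmove, ← hback]
  exact (bimoduleTprod k A B n).map_coord_zero p (Function.update_self _ _ _)

variable (k B) in
/-- The span of the right submodules `B e_j A` of a bimodule `B`, for `j` in `U`. -/
def idempotentSpan {V : Type*} (e : V → A) (U : Set V) : Submodule k B :=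
  Submodule.span k {b | ∃ j ∈ U, ∃ (a : A) (g : B), b = op a • op (e j) • g}

theorem bimoduleTprod_eq_zero_of_mem_idempotentSpan {V : Type*} {e : V → A}
    (he : ∀ j, IsIdempotentElem (e j)) {U : Set V} {n : ℕ} {f : Fin n → B} {p q : Fin n}
    (hpq : (q : ℕ) = p + 1) (hf : f p ∈ idempotentSpan k B e U)
    (h : ∀ j ∈ U, ∀ f' : Fin n → B, e j • f' q = f' q → bimoduleTprod k A B n f' = 0) :
    bimoduleTprod k A B n f = 0 := by
  have hne : p ≠ q := fun h => by simp [h] at hpq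
  have hle : idempotentSpan k B e U ≤
      LinearMap.ker ((bimoduleTprod k A B n).toLinearMap f p) := by
    refine Submodule.span_le.2 ?_
    rintro _ ⟨j, hj, a, g, rfl⟩
    change bimoduleTprod k A B n (Function.update f p (op a • op (e j) • g)) = 0
    rw [bimoduleTprod_update_op_smul f hpq, Function.update_comm hne,
      bimoduleTprod_update_op_smul _ hpq, Function.update_self]
    refine h j hj _ ?_
    rw [Function.update_self, smul_smul, (he j).eq]
  have hzero : bimoduleTprod k A B n (Function.update f p (f p)) = 0 := hle hf
  rwa [Function.update_eq_self] at hzero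

variable {V : Type*} {e : V → A} (d : V → ℕ) {l : ℕ}

/- A factor fixed by `e i` either spreads over the `B e_j A` with `d j > d i`, which moves the
problem to the next factor, or it is annihilated by an element dividing the next factor. Since `d`
is at most `l`, the second case is reached before the last factor. -/
theorem bimoduleTprod_eq_zero_of_smul_eq (hidem : ∀ i, IsIdempotentElem (e i))
    (hd : ∀ i, d i ≤ l)
    (H : ∀ i, (∀ f : B, e i • f = f → f ∈ idempotentSpan k B e {j | d i < d j}) ∨
      ∃ a : A, ∀ f : B, e i • f = f → op (e i) • f = f ∧ op a • f = 0 ∧ ∃ h : B, f = a • h)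
    {p : Fin (l + 2)} {f : Fin (l + 2) → B} {i : V} (hp : p ≤ d i) (hf : e i • f p = f p) :
    bimoduleTprod k A B (l + 2) f = 0 := by
  have hpl := hp.trans (hd i)
  obtain ⟨q, hpq⟩ : ∃ q : Fin (l + 2), (q : ℕ) = p + 1 := ⟨⟨p + 1, by lia⟩, rfl⟩
  rcases H i with hi | ⟨a, ha⟩
  · refine bimoduleTprod_eq_zero_of_mem_idempotentSpan hidem hpq (hi _ hf) fun j hij f' hf' => ?_
    have hlt : d i < d j := hij
    exact bimoduleTprod_eq_zero_of_smul_eq hidem hd H (by lia) hf'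
  · obtain ⟨hep, hap, -⟩ := ha _ hf
    refine bimoduleTprod_eq_zero_of_op_smul_eq_zero hpq hep hap (ha _ ?_).2.2
    rw [smul_smul, (hidem i).eq]
termination_by l - p
decreasing_by
  have := hd j
  lia

theorem subsingleton_bimoduleTensorPower [Fintype V] (he : CompleteOrthogonalIdempotents e)
    (hd : ∀ i, d i ≤ l)
    (H : ∀ i, (∀ f : B, e i • f = f → f ∈ idempotentSpan k B e {j | d i < d j}) ∨
      ∃ a : A, ∀ f : B, e i • f = f → op (e i) • f = f ∧ op a • f = 0 ∧ ∃ h : B, f = a • h) :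
    Subsingleton (BimoduleTensorPower k A B (l + 2)) := by
  refine subsingleton_bimoduleTensorPower_of_bimoduleTprod_eq_zero fun f => ?_
  have hf : f = Function.update f 0 (∑ i, e i • f 0) := by
    rw [← Finset.sum_smul, he.complete, one_smul, Function.update_eq_self]
  rw [hf, MultilinearMap.map_update_sum]
  refine Finset.sum_eq_zero fun i _ =>
    bimoduleTprod_eq_zero_of_smul_eq d he.idem hd H (p := 0) (i := i) (by simp) ?_
  rw [Function.update_self, smul_smul, (he.idem i).eq]

end TensorPower

namespace SerreBimodule

variable {k : Type*} [Field k] {A : Type*} [Ring A] [Algebra k A] {e a : A} {f : SerreBimodule k A}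

theorem exists_apply_eq_one (ha : a ≠ 0) : ∃ φ : SerreBimodule k A, φ a = 1 := by
  obtain ⟨φ, hφ⟩ := not_forall.1 (mt (Module.forall_dual_apply_eq_zero_iff k a).1 ha)
  exact ⟨((φ a)⁻¹ • φ : Module.Dual k A), inv_mul_cancel₀ hφ⟩

theorem map_smul (f : SerreBimodule k A) (c : k) (a : A) : f (c • a) = c * f a :=
  LinearMap.map_smul (f : A →ₗ[k] k) c a

theorem map_zero (f : SerreBimodule k A) : f 0 = 0 :=
  LinearMap.map_zero (f : A →ₗ[k] k)

theorem apply_mul_of_smul_eq (hf : e • f = f) (x : A) : f (x * e) = f x :=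
  DFunLike.congr_fun hf x

theorem op_smul_eq_zero (hf : e • f = f) (ha : ∀ x, a * x * e = 0) : op a • f = 0 :=
  DFunLike.ext _ _ fun x => by
    rw [op_smul_apply, ← apply_mul_of_smul_eq hf, ha, map_zero]
    rfl

theorem op_smul_apply_of_smul_eq (hf : e • f = f) {x : A} {c : k} (hc : e * x * e = c • e) :
    (op e • f) x = f e * c := by
  rw [op_smul_apply, ← apply_mul_of_smul_eq hf, hc, map_smul, mul_comm]

section

variable (he : ∀ x : A, ∃ c : k, e * x * e = c • e) (hf : e • f = f) (ha : a ≠ 0)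
include he hf ha

theorem exists_op_smul_eq_op_smul (hae : a * e = a) :
    ∃ g : SerreBimodule k A, op e • f = op a • g := by
  obtain ⟨φ, hφ⟩ := exists_apply_eq_one (k := k) ha
  refine ⟨f e • e • φ, DFunLike.ext _ _ fun x => ?_⟩
  obtain ⟨c, hc⟩ := he x
  have hax : a * x * e = c • a := by
    nth_rw 1 [← hae]
    rw [mul_assoc a, mul_assoc a, hc, mul_smul_comm, hae]
  rw [op_smul_apply_of_smul_eq hf hc]
  change _ = f e * φ (a * x * e)
  rw [hax, map_smul, hφ, mul_one]

theorem exists_op_smul_eq_smul (hae : e * a = a) :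
    ∃ g : SerreBimodule k A, op e • f = a • g := by
  obtain ⟨φ, hφ⟩ := exists_apply_eq_one (k := k) ha
  refine ⟨f e • op e • φ, DFunLike.ext _ _ fun x => ?_⟩
  obtain ⟨c, hc⟩ := he x
  have hxa : e * (x * a) = c • a := by
    rw [← hae, ← mul_assoc, ← mul_assoc, hc, smul_mul_assoc]
  rw [op_smul_apply_of_smul_eq hf hc]
  change _ = f e * φ (e * (x * a))
  rw [hxa, map_smul, hφ, mul_one]

end

end SerreBimodule

namespace IsDirectedFamily

variable {k : Type*} [Field k] {A : Type*} [Ring A] [Algebra k A] {V : Type*} [Fintype V]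
  [LinearOrder V] {e : V → A} (he : IsDirectedFamily k e) {i j : V} {a : A} (ha : a ≠ 0)
  {f : SerreBimodule k A} (hf : e i • f = f)
include he ha hf

theorem mem_idempotentSpan {U : Set V} (hj : j ∈ U) (hae : e j * a * e i = a)
    (hU : ∀ t, t ≠ i → t ∉ U → ∀ x, e t * x * e i = 0) :
    f ∈ idempotentSpan k (SerreBimodule k A) e U := by
  rw [← he.sum_op_smul f]
  refine Submodule.sum_mem _ fun t _ => ?_
  by_cases ht : t ∈ U
  · refine Submodule.subset_span ⟨t, ht, e t, f, ?_⟩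
    rw [smul_smul, ← op_mul, (he.idem t).eq]
  rcases eq_or_ne t i with rfl | hti
  · have haet : a * e t = a := by rw [← hae, mul_assoc, (he.idem t).eq]
    have heja : e j * a = a := by rw [← hae, ← mul_assoc, ← mul_assoc, (he.idem j).eq]
    obtain ⟨g, hg⟩ := SerreBimodule.exists_op_smul_eq_op_smul (he.exists_smul t) hf ha haet
    refine Submodule.subset_span ⟨j, hj, a, g, ?_⟩
    rw [hg, smul_smul, ← op_mul, heja]
  · rw [SerreBimodule.op_smul_eq_zero hf (hU t hti ht)]
    exact Submodule.zero_mem _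

theorem op_smul_eq_and_exists_eq_smul (hji : j ≠ i) (hae : e i * a * e j = a)
    (hi : ∀ t, t ≠ i → ∀ x, e t * x * e i = 0) :
    op (e i) • f = f ∧ op a • f = 0 ∧ ∃ h : SerreBimodule k A, f = a • h := by
  have hfi : op (e i) • f = f := by
    have hsum := he.sum_op_smul f
    rwa [Finset.sum_eq_single i (fun t _ ht => SerreBimodule.op_smul_eq_zero hf (hi t ht))
      (by simp)] at hsum
  have heia : e i * a = a := by rw [← hae, ← mul_assoc, ← mul_assoc, (he.idem i).eq]
  refine ⟨hfi, SerreBimodule.op_smul_eq_zero hf fun x => ?_, ?_⟩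
  · rw [← hae, mul_assoc _ (e j), mul_assoc, hi j hji, mul_zero]
  · obtain ⟨h, hh⟩ := SerreBimodule.exists_op_smul_eq_smul (he.exists_smul i) hf ha heia
    exact ⟨h, hfi.symm.trans hh⟩

end IsDirectedFamily

/-! ### Paths in quivers -/

section Quivers

open Quiver

variable {V : Type v} [Quiver.{w} V]

theorem le_of_path_of_isOrdered [LinearOrder V] (hV : IsOrdered V) {a b : V} (p : Path a b) :
    a ≤ b := by
  induction p with
  | nil => exact le_rfl
  | cons _ f ih => exact ih.trans (hV _ _ f).le

theorem path_eq_nil_of_isOrdered [LinearOrder V] (hV : IsOrdered V) {a : V} (p : Path a a) :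
    p = .nil := by
  cases p with
  | nil => rfl
  | cons p f => exact absurd (hV _ _ f) (le_of_path_of_isOrdered hV p).not_gt

theorem finite_path_of_isOrdered [LinearOrder V] [Finite V] (hV : IsOrdered V)
    (hfin : ∀ a b : V, Finite (a ⟶ b)) (a b : V) : Finite (Path a b) := by
  induction b using WellFoundedLT.induction with
  | ind b ih =>
    have (c : {c // c < b}) : Finite (Path a c.1) := ih c.1 c.2
    let splitLast : Path a b → Option (Σ c : {c // c < b}, Path a c.1 × (c.1 ⟶ b)) := fun p =>
      match p with
      | .nil => none
      | .cons q f => some ⟨⟨_, hV _ _ f⟩, q, f⟩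
    refine Finite.of_injective splitLast fun p q hpq => ?_
    cases p with
    | nil =>
      cases q with
      | nil => rfl
      | cons q f => simp [splitLast] at hpq
    | cons p f =>
      cases q with
      | nil => simp [splitLast] at hpq
      | cons q g =>
        simp only [splitLast, Option.some.injEq, Sigma.mk.injEq, Subtype.mk.injEq] at hpq
        obtain ⟨rfl, h⟩ := hpq
        simp only [heq_eq_eq, Prod.mk.injEq] at h
        rw [h.1, h.2]

theorem exists_hom_of_isConnected [Nontrivial V] (hV : IsConnected V) (i : V) :
    ∃ j : V, Nonempty (i ⟶ j) ∨ Nonempty (j ⟶ i) := by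
  obtain ⟨j, hj⟩ := exists_ne i
  obtain ⟨p⟩ := (WeaklyConnectedComponent.eq j i).1 (hV.2.elim _ _)
  cases p with
  | nil => exact absurd rfl hj
  | cons _ f => exact ⟨_, f.elim (fun f => .inr ⟨f⟩) fun f => .inl ⟨f⟩⟩

/-- The maximal length of a path ending at a vertex, where paths have bounded length; otherwise the
supremum may be the junk value `0`. -/
def pathDepth (j : V) : ℕ := sSup {n | ∃ (a : V) (p : Path a j), p.length = n}

variable {l : ℕ} (hl : HasLength V l)
include hl

theorem bddAbove_length_of_hasLength (j : V) :
    BddAbove {n | ∃ (a : V) (p : Path a j), p.length = n} :=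
  ⟨l, fun _ ⟨a, p, hp⟩ => hl.2 ⟨a, j, p, hp⟩⟩

theorem exists_length_eq_pathDepth (j : V) : ∃ (a : V) (p : Path a j), p.length = pathDepth j :=
  Nat.sSup_mem (s := {n | ∃ (a : V) (p : Path a j), p.length = n}) ⟨0, j, .nil, rfl⟩
    (bddAbove_length_of_hasLength hl j)

theorem pathDepth_le (j : V) : pathDepth j ≤ l :=
  let ⟨a, p, hp⟩ := exists_length_eq_pathDepth hl j
  hl.2 ⟨a, j, p, hp⟩

theorem pathDepth_lt_of_path {i j : V} (p : Path i j) (hij : i ≠ j) :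
    pathDepth i < pathDepth j := by
  obtain ⟨a, q, hq⟩ := exists_length_eq_pathDepth hl i
  have hle : (q.comp p).length ≤ pathDepth j :=
    le_csSup (bddAbove_length_of_hasLength hl j) ⟨a, q.comp p, rfl⟩
  have hpos : p.length ≠ 0 := fun h => hij (p.eq_of_length_zero h)
  rw [Path.length_comp] at hle
  lia

end Quivers

/-! ### Path algebras with relations -/

namespace PathAlgebra

variable {k : Type u} [Field k] {V : Type v} [Quiver.{w} V] [Fintype V]

theorem coord_toPath_eq_zero_of_mem_arrowIdeal_sq [DecidableEq V] {a b : V} (f : a ⟶ b)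
    {x : PathAlgebra k V} (hx : x ∈ arrowIdeal k V ^ 2) :
    (pathBasis k V).coord ⟨a, b, f.toPath⟩ x = 0 := by
  suffices arrowIdeal k V ^ 2 ≤ LinearMap.ker ((pathBasis k V).coord ⟨a, b, f.toPath⟩) from this hx
  rw [pow_two, arrowIdeal, Submodule.span_mul_span, Submodule.span_le]
  rintro _ ⟨_, ⟨⟨c, d, p⟩, hp, rfl⟩, _, ⟨⟨c', d', q⟩, hq, rfl⟩, rfl⟩
  change (pathBasis k V).coord _ (ofPath k ⟨c, d, p⟩ * ofPath k ⟨c', d', q⟩) = 0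
  by_cases h : c = d'
  · subst h
    have hne : (⟨a, b, f.toPath⟩ : QuiverPath V) ≠ ⟨c', d, q.comp p⟩ := fun h => by
      have hlength : f.toPath.length = (q.comp p).length :=
        congrArg (fun t : QuiverPath V => t.2.2.length) h
      rw [Quiver.Path.length_comp, Quiver.Path.length_toPath] at hlength
      dsimp only at hp hq
      lia
    rw [ofPath_mul_ofPath_comp, ofPath, Module.Basis.coord_apply, Module.Basis.repr_self,
      Finsupp.single_eq_of_ne hne]
  · rw [ofPath_mul_ofPath_of_ne _ _ h, map_zero]

variable [LinearOrder V] {I : TwoSidedIdeal (PathAlgebra k V)} {a b c : V}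

variable (I) in
/-- The quotient map from the path algebra to the path algebra with relations. -/
def toWithRelations : PathAlgebra k V →ₐ[k] WithRelations I :=
  { I.ringCon.mk' with commutes' := fun _ => rfl }

theorem toWithRelations_surjective : Function.Surjective (toWithRelations I) :=
  I.ringCon.mk'_surjective

theorem toWithRelations_eq_zero_iff {x : PathAlgebra k V} : toWithRelations I x = 0 ↔ x ∈ I := by
  rw [TwoSidedIdeal.mem_iff, ← RingCon.eq]
  rfl

theorem finiteDimensional_withRelations (hfin : ∀ a b : V, Finite (a ⟶ b))
    (hord : Quiver.IsOrdered V) : FiniteDimensional k (WithRelations I) :=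
  have := finite_path_of_isOrdered hord hfin
  have : FiniteDimensional k (PathAlgebra k V) := Module.Finite.of_basis (pathBasis k V)
  .of_surjective (toWithRelations I).toLinearMap toWithRelations_surjective

variable (I) in
/-- The class of a path in the path algebra with relations. -/
def pathClass (p : Quiver.Path a b) : WithRelations I :=
  toWithRelations I (ofPath k ⟨a, b, p⟩)

theorem pathClass_mul_comp (q : Quiver.Path a b) (p : Quiver.Path b c) :
    pathClass I p * pathClass I q = pathClass I (q.comp p) := by
  rw [pathClass, pathClass, ← map_mul, ofPath_mul_ofPath_comp, pathClass]

theorem pathClass_mul_of_ne {b' : V} (q : Quiver.Path a b') (p : Quiver.Path b c) (h : b ≠ b') :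
    pathClass I p * pathClass I q = 0 := by
  rw [pathClass, pathClass, ← map_mul, ofPath_mul_ofPath_of_ne _ _ h, map_zero]

theorem pathClass_toPath_ne_zero (hI : IsIdealOfRelations I) (f : a ⟶ b) :
    pathClass I f.toPath ≠ 0 := by
  intro h
  have hcoord := coord_toPath_eq_zero_of_mem_arrowIdeal_sq f
    (hI _ (toWithRelations_eq_zero_iff.1 h))
  rw [ofPath, Module.Basis.coord_apply, Module.Basis.repr_self, Finsupp.single_eq_same] at hcoord
  exact one_ne_zero hcoord

variable (I) in
/-- The idempotent of a vertex. -/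
def vertexIdem (i : V) : WithRelations I := pathClass I (Quiver.Path.nil : Quiver.Path i i)

theorem vertexIdem_mul_pathClass (p : Quiver.Path a b) :
    vertexIdem I b * pathClass I p = pathClass I p := pathClass_mul_comp p .nil

theorem pathClass_mul_vertexIdem (p : Quiver.Path a b) :
    pathClass I p * vertexIdem I a = pathClass I p := by
  rw [vertexIdem, pathClass_mul_comp, Quiver.Path.nil_comp]

theorem vertexIdem_mul_pathClass_mul_vertexIdem (p : Quiver.Path a b) :
    vertexIdem I b * pathClass I p * vertexIdem I a = pathClass I p := by
  rw [vertexIdem_mul_pathClass, pathClass_mul_vertexIdem]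

theorem vertexIdem_mul_mul_vertexIdem_mem (i j : V) (P : Submodule k (WithRelations I))
    (hP : ∀ p : Quiver.Path j i, pathClass I p ∈ P) (x : WithRelations I) :
    vertexIdem I i * x * vertexIdem I j ∈ P := by
  obtain ⟨x, rfl⟩ := toWithRelations_surjective x
  induction x using induction_ofPath with
  | zero => simp
  | add x y hx hy =>
    rw [map_add, mul_add, add_mul]
    exact P.add_mem hx hy
  | smul c x hx =>
    rw [map_smul, mul_smul_comm, smul_mul_assoc]
    exact P.smul_mem c hx
  | path p =>
    obtain ⟨a, b, p⟩ := p
    change vertexIdem I i * pathClass I p * vertexIdem I j ∈ P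
    rcases ne_or_eq i b with hb | rfl
    · rw [vertexIdem, pathClass_mul_of_ne _ _ hb, zero_mul]
      exact P.zero_mem
    rcases ne_or_eq a j with ha | rfl
    · rw [vertexIdem_mul_pathClass, vertexIdem, pathClass_mul_of_ne _ _ ha]
      exact P.zero_mem
    · rw [vertexIdem_mul_pathClass_mul_vertexIdem]
      exact hP p

theorem vertexIdem_mul_mul_vertexIdem_eq_zero {i j : V} (h : IsEmpty (Quiver.Path j i))
    (x : WithRelations I) : vertexIdem I i * x * vertexIdem I j = 0 :=
  (Submodule.mem_bot k).1 (vertexIdem_mul_mul_vertexIdem_mem i j ⊥ h.elim x)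

theorem completeOrthogonalIdempotents_vertexIdem :
    CompleteOrthogonalIdempotents (vertexIdem I) where
  idem _ := vertexIdem_mul_pathClass _
  ortho _ _ h := pathClass_mul_of_ne _ _ h
  complete := by
    have h : (1 : PathAlgebra k V) = ∑ i : V, ofPath k ⟨i, i, Quiver.Path.nil⟩ := rfl
    rw [← map_one (toWithRelations I), h, map_sum]
    rfl

theorem isDirectedFamily_vertexIdem (hord : Quiver.IsOrdered V) :
    IsDirectedFamily k (vertexIdem I) where
  toCompleteOrthogonalIdempotents := completeOrthogonalIdempotents_vertexIdem
  eq_zero_of_lt i j x hij := vertexIdem_mul_mul_vertexIdem_eq_zero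
    ⟨fun p => (le_of_path_of_isOrdered hord p).not_gt hij⟩ x
  exists_smul i x := by
    have h : vertexIdem I i * x * vertexIdem I i ∈ Submodule.span k {vertexIdem I i} := by
      refine vertexIdem_mul_mul_vertexIdem_mem i i _ (fun p => ?_) x
      rw [path_eq_nil_of_isOrdered hord p]
      exact Submodule.mem_span_singleton_self _
    obtain ⟨c, hc⟩ := Submodule.mem_span_singleton.1 h
    exact ⟨c, hc.symm⟩

section SerreBimodule

variable (hord : Quiver.IsOrdered V) (hI : IsIdealOfRelations I)
  {f : SerreBimodule k (WithRelations I)}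
include hord hI

theorem mem_idempotentSpan_pathDepth_of_hom {l : ℕ} (hl : Quiver.HasLength V l) (φ : a ⟶ b)
    (hf : vertexIdem I a • f = f) :
    f ∈ idempotentSpan k (SerreBimodule k (WithRelations I)) (vertexIdem I)
      {j | pathDepth a < pathDepth j} :=
  (isDirectedFamily_vertexIdem hord).mem_idempotentSpan (pathClass_toPath_ne_zero hI φ) hf
    (pathDepth_lt_of_path hl φ.toPath (hord _ _ φ).ne)
    (vertexIdem_mul_pathClass_mul_vertexIdem _) fun _ hta ht =>
      vertexIdem_mul_mul_vertexIdem_eq_zero ⟨fun p => ht (pathDepth_lt_of_path hl p hta.symm)⟩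

theorem exists_eq_pathClass_smul_of_sink (ha : ∀ j, IsEmpty (a ⟶ j)) (φ : b ⟶ a)
    (hf : vertexIdem I a • f = f) :
    op (vertexIdem I a) • f = f ∧ op (pathClass I φ.toPath) • f = 0 ∧
      ∃ h : SerreBimodule k (WithRelations I), f = pathClass I φ.toPath • h := by
  refine (isDirectedFamily_vertexIdem hord).op_smul_eq_and_exists_eq_smul
    (pathClass_toPath_ne_zero hI φ) hf (hord _ _ φ).ne (vertexIdem_mul_pathClass_mul_vertexIdem _)
    fun t ht => vertexIdem_mul_mul_vertexIdem_eq_zero ⟨fun p => ?_⟩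
  obtain ⟨c, g, -⟩ := p.eq_toPath_comp_of_length_eq_succ
    (Nat.succ_pred_eq_of_ne_zero fun h => ht (p.eq_of_length_zero h).symm).symm
  exact (ha c).elim g

theorem subsingleton_bimoduleTensorPower_serreBimodule {l : ℕ} (hl : Quiver.HasLength V l)
    (hiso : ∀ i : V, ∃ j, Nonempty (i ⟶ j) ∨ Nonempty (j ⟶ i)) :
    Subsingleton (BimoduleTensorPower k (WithRelations I)
      (SerreBimodule k (WithRelations I)) (l + 2)) := by
  refine subsingleton_bimoduleTensorPower pathDepth completeOrthogonalIdempotents_vertexIdem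
    (pathDepth_le hl) fun i => ?_
  by_cases hi : ∃ j, Nonempty (i ⟶ j)
  · obtain ⟨j, ⟨φ⟩⟩ := hi
    exact .inl fun f => mem_idempotentSpan_pathDepth_of_hom hord hI hl φ
  · simp only [not_exists, not_nonempty_iff] at hi
    obtain ⟨j, hj⟩ := hiso i
    obtain ⟨φ⟩ := hj.resolve_left (not_nonempty_iff.2 (hi j))
    exact .inr ⟨_, fun f => exists_eq_pathClass_smul_of_sink hord hI hi φ⟩

end SerreBimodule

end PathAlgebra

end

theorem mainTheorem3_general {k : Type u} [Field k] {V : Type v} [Quiver.{w} V] [Fintype V]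
    [LinearOrder V] (hfin : ∀ a b : V, Finite (a ⟶ b)) (hord : Quiver.IsOrdered V)
    (hiso : ∀ i : V, ∃ j, Nonempty (i ⟶ j) ∨ Nonempty (j ⟶ i))
    (l : ℕ) (hl : Quiver.HasLength V l)
    (I : TwoSidedIdeal (PathAlgebra k V)) (hI : PathAlgebra.IsIdealOfRelations I)
    [HasDerivedCategory.{u'} (ModuleCat.{max u v w} (PathAlgebra.WithRelations I)ᵐᵒᵖ)] :
    Nonempty (SerreFunctor k (Perf (PathAlgebra.WithRelations I))) ∧
    (∃ G : Perf (PathAlgebra.WithRelations I), IsClassicalGenerator G) ∧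
    (∀ (S : SerreFunctor k (Perf (PathAlgebra.WithRelations I)))
      (G : Perf (PathAlgebra.WithRelations I)),
        ((1 / ((l : ℝ) + 2) : ℝ) : EReal) ≤ LSdim S.functor G ∧ 0 < LSdim S.functor G) ∧
    Subsingleton (BimoduleTensorPower k (PathAlgebra.WithRelations I)
      (SerreBimodule k (PathAlgebra.WithRelations I)) (l + 2)) := by
  have := PathAlgebra.finiteDimensional_withRelations (I := I) hfin hord
  have he := PathAlgebra.isDirectedFamily_vertexIdem (I := I) hord
  have htensor := PathAlgebra.subsingleton_bimoduleTensorPower_serreBimodule hord hI hl hiso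
  refine ⟨IsDirectedFamily.nonempty_serreFunctor_perf.{u, max v w} he,
    ⟨_, isClassicalGenerator_regularPerf⟩, fun S G => ?_, htensor⟩
  have hle : ((1 / ((l : ℝ) + 2) : ℝ) : EReal) ≤ LSdim S.functor G := by
    exact_mod_cast S.one_div_le_LSdim htensor (Nat.succ_pos _) G
  exact ⟨hle, (EReal.coe_pos.2 (by positivity)).trans_le hle⟩

theorem mainTheorem3 {k : Type u} [Field k] {V : Type v} [Quiver.{w} V] [Fintype V]
    [LinearOrder V] (hfin : ∀ a b : V, Finite (a ⟶ b)) (hord : Quiver.IsOrdered V)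
    (hconn : Quiver.IsConnected V) (hnontriv : Nontrivial V)
    (l : ℕ) (hl : Quiver.HasLength V l)
    (I : TwoSidedIdeal (PathAlgebra k V)) (hI : PathAlgebra.IsIdealOfRelations I)
    [HasDerivedCategory.{u'} (ModuleCat.{max u v w} (PathAlgebra.WithRelations I)ᵐᵒᵖ)] :
    Nonempty (SerreFunctor k (Perf (PathAlgebra.WithRelations I))) ∧
    (∃ G : Perf (PathAlgebra.WithRelations I), IsClassicalGenerator G) ∧
    (∀ (S : SerreFunctor k (Perf (PathAlgebra.WithRelations I)))
      (G : Perf (PathAlgebra.WithRelations I)), IsClassicalGenerator G →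
        ((1 / ((l : ℝ) + 2) : ℝ) : EReal) ≤ LSdim S.functor G ∧ 0 < LSdim S.functor G) ∧
    Subsingleton (BimoduleTensorPower k (PathAlgebra.WithRelations I)
      (SerreBimodule k (PathAlgebra.WithRelations I)) (l + 2)) := by
  obtain ⟨hS, hG, hLS, htensor⟩ :=
    mainTheorem3_general hfin hord (exists_hom_of_isConnected hconn) l hl I hI
  exact ⟨hS, hG, fun S G _ => hLS S G, htensor⟩
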